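/- **Theorem 4.1 (Full rank theorem).** Let $n\ge 1$, let $\mathbb{S}^n\subset\mathbb{R}^{n+1}$ be the unit sphere with its standard round metric, and let $D$, $D^2$, $\Delta$ and $d\sigma$ denote its gradient (covariant derivative), Hessian, Laplace operator and area element. Let $f:\mathbb{S}^n\to(0,\infty)$ be smooth and such that (1) $f$ is even, i.e. $f(-x)=f(x)$ for all $x\in\mathbb{S}^n$; (2) the matrix $$D^2(f^{-1})-|D f^{-1}|\,I+\frac{f^{-1}}{\frac{8}{n}\max_{\mathbb{S}^n}f+2}\,I$$ is positive semi-definite at every point of $\mathbb{S}^n$. Let $\varphi:\mathbb{S}^n\to(0,\infty)$ be an even function of class $C^4$ that solves $$\Delta\varphi-\frac n2\frac{|D\varphi|^2}{\varphi}+\frac n2\Big(\varphi-\frac1\varphi\Big)=\varphi^{-1}f\qquad\text{on }\mathbb{S}^n ,$$ and put $$U[\varphi]=D^2\varphi-\frac12\frac{|D\varphi|^2}{\varphi}I+\frac12\Big(\varphi-\frac1\varphi\Big)I .$$ Suppose that $\varphi$ is $h$-convex, i.e. $U[\varphi]$ is positive semi-definite at every point of $\mathbb{S}^n$, and that for every integer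 $0\le k\le n-1$ $$\int_{\mathbb{S}^n}\varphi^{k-n}\sigma_{k+1}(U[\varphi])\,d\sigma=\frac{\binom{n}{k+1}}{\binom{n}{k}}\int_{\mathbb{S}^n}\Big[\frac{|D\varphi|^2}{2\varphi}+\frac12\big(\varphi-\varphi^{-1}\big)\Big]\varphi^{k-n}\sigma_k(U[\varphi])\,d\sigma ,$$ where $\sigma_k(A)$ is the $k$-th elementary symmetric function of the eigenvalues of the symmetric matrix $A$, and $\sigma_0=1$. Then $\varphi$ is uniformly $h$-convex, i.e. $U[\varphi]$ is positive definite at every point of $\mathbb{S}^n$ (so $\varphi$ is an even, uniformly $h$-convex solution of the equation). -/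

import Mathlib

open scoped Manifold ContDiff RealInnerProductSpace

namespace HypChristoffel

/-- The ambient Euclidean space `ℝⁿ⁺¹`. -/
abbrev Amb (n : ℕ) : Type := EuclideanSpace ℝ (Fin (n + 1))

/-- The unit sphere `𝕊ⁿ ⊂ ℝⁿ⁺¹`. -/
abbrev Sph (n : ℕ) : Type := Metric.sphere (0 : Amb n) 1

/-- The tangent space `T_x 𝕊ⁿ = x^⊥`, an `n`-dimensional inner product space whose inner product
is the value at `x` of the standard round metric. -/
noncomputable abbrev Tan {n : ℕ} (x : Sph n) : Submodule ℝ (Amb n) := (ℝ ∙ (x : Amb n))ᗮ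

open Classical in
/-- The extension of a function on the sphere to `ℝⁿ⁺¹ ∖ {0}` that is constant along rays,
`y ↦ f (y / |y|)` (the value at the origin plays no role). -/
noncomputable def radExt {n : ℕ} (f : Sph n → ℝ) (y : Amb n) : ℝ :=
  if h : y ≠ 0 then f ⟨‖y‖⁻¹ • y, by simp [norm_smul, h]⟩ else 0

/-- The ambient gradient of the radially constant extension. At points of the sphere its radial
part vanishes, so that it is there the gradient vector field `Df` of the round sphere. -/
noncomputable def gradField {n : ℕ} (f : Sph n → ℝ) (y : Amb n) : Amb n :=
  gradient (radExt f) y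

/-- The gradient `Df(x) ∈ T_x 𝕊ⁿ`. -/
noncomputable def grad {n : ℕ} (f : Sph n → ℝ) (x : Sph n) : Tan x :=
  (Tan x).orthogonalProjectionOnto (gradField f x)

/-- The Hessian `D²f(x)`, as the endomorphism `v ↦ D_v (Df)` of `T_x 𝕊ⁿ`. The Levi-Civita
connection `D` of the round sphere is the tangential part of the ambient derivative. -/
noncomputable def hess {n : ℕ} (f : Sph n → ℝ) (x : Sph n) : Tan x →ₗ[ℝ] Tan x :=
  ((Tan x).orthogonalProjectionOnto ∘L fderiv ℝ (gradField f) x ∘L (Tan x).subtypeL : Tan x →L[ℝ] Tan x)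

/-- The Laplace–Beltrami operator `Δf = tr D²f`. -/
noncomputable def lap {n : ℕ} (f : Sph n → ℝ) (x : Sph n) : ℝ :=
  LinearMap.trace ℝ (Tan x) (hess f x)

/-- `U[φ] = D²φ - ½ (|Dφ|²/φ) I + ½ (φ - 1/φ) I`. -/
noncomputable def U {n : ℕ} (φ : Sph n → ℝ) (x : Sph n) : Tan x →ₗ[ℝ] Tan x :=
  hess φ x - ((1 / 2) * (‖grad φ x‖ ^ 2 / φ x)) • LinearMap.id
    + ((1 / 2) * (φ x - 1 / φ x)) • LinearMap.id

/-- Positive definiteness of an endomorphism of a real inner product space. -/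
def PosDef {V : Type*} [NormedAddCommGroup V] [InnerProductSpace ℝ V] (A : V →ₗ[ℝ] V) : Prop :=
  A.IsSymmetric ∧ ∀ v : V, v ≠ 0 → 0 < ⟪A v, v⟫

/-- `σ_k(A)`: the `k`-th elementary symmetric function of the eigenvalues of `A`, counted with
multiplicity (`σ_0 = 1`). -/
noncomputable def sigma {V : Type*} [NormedAddCommGroup V] [InnerProductSpace ℝ V]
    [FiniteDimensional ℝ V] (k : ℕ) (A : V →ₗ[ℝ] V) : ℝ :=
  A.charpoly.roots.esymm k

/-- The area measure of `𝕊ⁿ`. -/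
noncomputable def area (n : ℕ) : MeasureTheory.Measure (Sph n) :=
  (MeasureTheory.volume : MeasureTheory.Measure (Amb n)).toSphere

/-- Even functions on the sphere. -/
def IsEven {n : ℕ} (f : Sph n → ℝ) : Prop := ∀ x, f (-x) = f x

/-- The matrix `D²(f⁻¹) - |D f⁻¹| I + f⁻¹ / ((8/n) max f + 2) I` is positive semi-definite
everywhere. -/
def CurvCondition {n : ℕ} (f : Sph n → ℝ) : Prop :=
  ∀ x : Sph n,
    (hess (fun y => (f y)⁻¹) x - ‖grad (fun y => (f y)⁻¹) x‖ • LinearMap.id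
      + ((f x)⁻¹ / (8 / (n : ℝ) * (⨆ y, f y) + 2)) • LinearMap.id : Tan x →ₗ[ℝ] Tan x).IsPositive

/-- Positive (classical, `C⁴`) solutions of
`Δφ - (n/2) |Dφ|²/φ + (n/2) (φ - 1/φ) = φ⁻¹ f`. -/
structure IsSolution {n : ℕ} (f φ : Sph n → ℝ) : Prop where
  contMDiff : ContMDiff (𝓡 n) 𝓘(ℝ, ℝ) 4 φ
  pos : ∀ x, 0 < φ x
  eqn : ∀ x, lap φ x - (n : ℝ) / 2 * (‖grad φ x‖ ^ 2 / φ x)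
    + (n : ℝ) / 2 * (φ x - 1 / φ x) = (φ x)⁻¹ * f x

/-- `h`-convex solutions: `U[φ]` is positive semi-definite everywhere. -/
def IsHConvexSolution {n : ℕ} (f φ : Sph n → ℝ) : Prop :=
  IsSolution f φ ∧ ∀ x, (U φ x).IsPositive

/-- Uniformly `h`-convex solutions: `U[φ]` is positive definite everywhere. -/
def IsUniformlyHConvexSolution {n : ℕ} (f φ : Sph n → ℝ) : Prop :=
  IsSolution f φ ∧ ∀ x, PosDef (U φ x)

/-- The integral identities relating consecutive `σ_k(U[φ])`, `0 ≤ k ≤ n - 1`. -/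
def IntegralIdentity {n : ℕ} (φ : Sph n → ℝ) : Prop :=
  ∀ k : ℕ, k < n →
    ∫ x, φ x ^ ((k : ℤ) - (n : ℤ)) * sigma (k + 1) (U φ x) ∂(area n)
      = ((n.choose (k + 1) : ℝ) / (n.choose k : ℝ)) *
        ∫ x, (‖grad φ x‖ ^ 2 / (2 * φ x) + (1 / 2) * (φ x - (φ x)⁻¹))
          * φ x ^ ((k : ℤ) - (n : ℤ)) * sigma k (U φ x) ∂(area n)

end HypChristoffel

/-! Let `Φ = homExt φ` be the extension of `φ` to `ℝⁿ⁺¹ ∖ {0}` that is homogeneous of degree one. On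
`x^⊥` one has `D²Φ = D²φ + φ I`, and `|∇Φ|² = |Dφ|² + φ²`. Hence `2 φ U[φ]` is the tangential part
of `2 Φ D²Φ - (1 + |∇Φ|²) I`, and the equation becomes `2 Φ ΔΦ - n |∇Φ|² = 2 f + n`. All derivatives
are now flat and commute, so no curvature terms appear.

Suppose `U[φ]` has a unit null vector `e` at `x`. The form `Q_y(v) = 2 Φ D²Φ(v, v) - (1 + |∇Φ|²)
|v^⊥|²`, with `v^⊥` the part of `v` orthogonal to `y`, is nonnegative for all `y ≠ 0` and all `v`,
and it vanishes at `(x, e)`. So `t ↦ Q_{x + t l}(e + t ξ)` has a minimum at `0` for every `l` and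
`ξ`. Letting `l` run through an orthonormal basis, choosing `ξ` well for each `l`, summing, and
inserting the twice differentiated equation gives for `g = 1 / f` (`null_point_inequality`) `0 ≤
-D²g(e, e) / g² + (∂_{∇Φ} g - 2 ∂_e g ∂_e Φ) / (g² φ) - 1 / (g φ²)`.

By the gradient bound `|Dφ| ≤ φ` (`one_add_norm_grad_sq_le`) the middle term is at most `|Dg| / g²`.
The condition on `f` then bounds the first two terms by `1 / (g c)` with `c = (8 / n) max f + 2`,
and the strict bound `φ² < c` (`sq_lt_of_solution`) makes the right side negative. The contradiction
is pointwise; strictness of the `C⁰` estimate takes the place of a strong maximum principle.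

Both estimates come from one comparison along great circles (`comparison_of_hconvex`): there
`h`-convexity reads `2 p (p'' + p) ≥ 1 + p'² + p²`, equality holds for `A + b cos t + c sin t` with
`A² = 1 + b² + c²`, and evenness supplies the value at the antipode. -/

namespace HypChristoffel
open Filter Topology

/-! ### Calculus in one variable: minima and comparison -/

/-- Second order necessary conditions at a zero minimum of `α + 2 t β + t² γ`. -/
theorem second_order_conditions {α α' β γ : ℝ → ℝ} {α'' β' : ℝ}
    (hα : ∀ᶠ t in 𝓝 0, HasDerivAt α (α' t) t) (hα' : HasDerivAt α' α'' 0)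
    (hβ : HasDerivAt β β' 0) (hγ : ContinuousAt γ 0) (hα0 : α 0 = 0) (hβ0 : β 0 = 0)
    (hnn : ∀ᶠ t in 𝓝 0, 0 ≤ α t + 2 * t * β t + t ^ 2 * γ t) :
    α' 0 = 0 ∧ 0 ≤ α'' + 4 * β' + 2 * γ 0 := by
  have hslope : ∀ {u : ℝ → ℝ} {u' : ℝ}, HasDerivAt u u' 0 → u 0 = 0 →
      Tendsto (fun t => u t / t) (𝓝[≠] 0) (𝓝 u') := by
    intro u u' hu hu0
    have := hu.tendsto_slope
    refine this.congr fun t => ?_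
    simp [slope_def_field, hu0]
  have hk : Tendsto (fun t => 2 * β t + t * γ t) (𝓝 0) (𝓝 0) := by
    have : ContinuousAt (fun t => 2 * β t + t * γ t) 0 :=
      (hβ.continuousAt.const_mul 2).add (continuousAt_id.mul hγ)
    simpa [ContinuousAt, hβ0] using this
  have h1 : Tendsto (fun t => α t / t + (2 * β t + t * γ t)) (𝓝[≠] 0) (𝓝 (α' 0)) := by
    simpa using (hslope hα.self_of_nhds hα0).add (hk.mono_left nhdsWithin_le_nhds)
  have hid : ∀ t : ℝ, t ≠ 0 →
      α t / t + (2 * β t + t * γ t) = (α t + 2 * t * β t + t ^ 2 * γ t) / t := by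
    intro t ht
    field_simp
    ring
  have hfirst : α' 0 = 0 := by
    apply le_antisymm
    · have h2 := h1.mono_left (nhdsLT_le_nhdsNE (0 : ℝ))
      refine le_of_tendsto h2 ?_
      filter_upwards [self_mem_nhdsWithin, hnn.filter_mono nhdsWithin_le_nhds] with t ht hn
      rw [hid t (ne_of_lt ht)]
      exact div_nonpos_of_nonneg_of_nonpos hn (le_of_lt ht)
    · have h2 := h1.mono_left (nhdsGT_le_nhdsNE (0 : ℝ))
      refine ge_of_tendsto h2 ?_
      filter_upwards [self_mem_nhdsWithin, hnn.filter_mono nhdsWithin_le_nhds] with t ht hn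
      rw [hid t (ne_of_gt ht)]
      exact div_nonneg hn (le_of_lt ht)
  refine ⟨hfirst, ?_⟩
  -- `α'` is differentiable only at `0`, so l'Hôpital is applied once and the limit of `α' t / t` is
  -- read off as a derivative.
  have hα2 : Tendsto (fun t => α t / t ^ 2) (𝓝[>] 0) (𝓝 (α'' / 2)) := by
    refine HasDerivAt.lhopital_zero_nhdsGT (f' := α') (g' := fun t => 2 * t)
      (hα.filter_mono nhdsWithin_le_nhds) ?_ ?_ ?_ ?_ ?_
    · filter_upwards with t
      simpa using hasDerivAt_pow 2 t
    · filter_upwards [self_mem_nhdsWithin] with t ht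
      exact mul_ne_zero two_ne_zero (ne_of_gt ht)
    · have := hα.self_of_nhds.continuousAt.tendsto
      rw [hα0] at this
      exact this.mono_left nhdsWithin_le_nhds
    · have : Tendsto (fun t : ℝ => t ^ 2) (𝓝 0) (𝓝 (0 ^ 2)) := (continuous_pow 2).tendsto 0
      simpa using this.mono_left (nhdsWithin_le_nhds (s := Set.Ioi 0))
    · have := ((hslope hα' hfirst).mono_left (nhdsGT_le_nhdsNE (0 : ℝ))).div_const 2
      refine this.congr fun t => ?_
      rw [div_div, mul_comm]
  have hlim : Tendsto (fun t => α t / t ^ 2 + 2 * (β t / t) + γ t) (𝓝[>] 0)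
      (𝓝 (α'' / 2 + 2 * β' + γ 0)) :=
    (hα2.add (((hslope hβ hβ0).mono_left (nhdsGT_le_nhdsNE (0 : ℝ))).const_mul 2)).add
      (hγ.tendsto.mono_left nhdsWithin_le_nhds)
  have : 0 ≤ α'' / 2 + 2 * β' + γ 0 := by
    refine ge_of_tendsto hlim ?_
    filter_upwards [self_mem_nhdsWithin, hnn.filter_mono nhdsWithin_le_nhds] with t ht hn
    have ht0 : t ≠ 0 := ne_of_gt ht
    have : α t / t ^ 2 + 2 * (β t / t) + γ t
        = (α t + 2 * t * β t + t ^ 2 * γ t) / t ^ 2 := by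
      field_simp
    rw [this]
    exact div_nonneg hn (sq_nonneg t)
  linarith

/-- A nonnegative second derivative at a minimum. -/
theorem second_deriv_nonneg_of_isMin {α α' : ℝ → ℝ} {α'' : ℝ}
    (hα : ∀ t, HasDerivAt α (α' t) t) (hα' : HasDerivAt α' α'' 0)
    (hmin : ∀ t, α 0 ≤ α t) : α' 0 = 0 ∧ 0 ≤ α'' := by
  have := second_order_conditions (α := fun t => α t - α 0) (α' := α') (α'' := α'')
    (β := fun _ => 0) (β' := 0) (γ := fun _ => 0)
    (Eventually.of_forall fun t => (hα t).sub_const (α 0)) hα' (hasDerivAt_const _ _)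
    continuousAt_const (by simp) rfl (Eventually.of_forall fun t => by simpa using hmin t)
  simpa using this

/-- Comparison of a solution of `2 p (p'' + p) ≥ 1 + p'² + p²` with the solution
`A + b cos t + c sin t` of the corresponding equation with the same initial data.
The function `χ = a₀ + a₁ cos t + a₂ sin t` solves the linearised equation. -/
theorem comparison_of_hconvex {p p' p'' : ℝ → ℝ} (hp : ∀ t, HasDerivAt p (p' t) t)
    (hp' : ∀ t, HasDerivAt p' (p'' t) t) (hpos : ∀ t, 0 < p t)
    (hineq : ∀ t, 1 + p' t ^ 2 + p t ^ 2 ≤ 2 * p t * (p'' t + p t))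
    {A b c : ℝ} (hA : 0 < A) (hl : A ^ 2 = 1 + b ^ 2 + c ^ 2) (h0 : p 0 = A + b)
    (h0' : p' 0 = c)
    {a₀ a₁ a₂ T : ℝ} (hT : 0 ≤ T) (ha : A * a₀ = b * a₁ + c * a₂)
    (hχ : ∀ t ∈ Set.Icc 0 T, 0 ≤ a₀ + a₁ * Real.cos t + a₂ * Real.sin t)
    (hχT : a₀ + a₁ * Real.cos T + a₂ * Real.sin T = 0)
    (hχT' : -a₁ * Real.sin T + a₂ * Real.cos T < 0) :
    A + b * Real.cos T + c * Real.sin T ≤ p T := by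
  set l : ℝ → ℝ := fun t => A + b * Real.cos t + c * Real.sin t with hldef
  set l' : ℝ → ℝ := fun t => -b * Real.sin t + c * Real.cos t with hl'def
  set χ : ℝ → ℝ := fun t => a₀ + a₁ * Real.cos t + a₂ * Real.sin t with hχdef
  set χ' : ℝ → ℝ := fun t => -a₁ * Real.sin t + a₂ * Real.cos t with hχ'def
  have hder : ∀ (u v w t : ℝ), HasDerivAt (fun t => u + v * Real.cos t + w * Real.sin t)
      (-v * Real.sin t + w * Real.cos t) t := by
    intro u v w t
    have := (((Real.hasDerivAt_cos t).const_mul v).const_add u).add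
      ((Real.hasDerivAt_sin t).const_mul w)
    exact this.congr_deriv (by ring)
  have hder' : ∀ (v w t : ℝ), HasDerivAt (fun t => -v * Real.sin t + w * Real.cos t)
      (-v * Real.cos t - w * Real.sin t) t := by
    intro v w t
    have := ((Real.hasDerivAt_sin t).const_mul (-v)).add ((Real.hasDerivAt_cos t).const_mul w)
    exact this.congr_deriv (by ring)
  have hcs : ∀ t, Real.sin t ^ 2 = 1 - Real.cos t ^ 2 := fun t => by
    linarith [Real.sin_sq_add_cos_sq t]
  have hlpos : ∀ t, 0 < l t := by
    intro t
    have h1 : (b * Real.cos t + c * Real.sin t) ^ 2 < A ^ 2 := by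
      have : (b * Real.cos t + c * Real.sin t) ^ 2
          = b ^ 2 + c ^ 2 - (b * Real.sin t - c * Real.cos t) ^ 2 := by
        linear_combination (b ^ 2 + c ^ 2) * Real.sin_sq_add_cos_sq t
      nlinarith [sq_nonneg (b * Real.sin t - c * Real.cos t)]
    have h2 := (abs_lt_of_sq_lt_sq' h1 hA.le).1
    simp only [hldef]
    linarith
  have hlid : ∀ t, l t * (2 * A - l t) = 1 + l' t ^ 2 := by
    intro t
    simp only [hldef, hl'def]
    linear_combination hl - (b ^ 2 + c ^ 2) * Real.sin_sq_add_cos_sq t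
  -- With `L = l ∂² - l' ∂ + A` one has `L l = 1`, so this is `L (p - l) ≥ 0`. After multiplication
  -- by `2 p l`, the excess is at least `(l p' - p l')² + (l - p)²`.
  have hlin : ∀ t, 1 ≤ l t * p'' t - l' t * p' t + A * p t := by
    intro t
    have hpt := hpos t
    have hlt := hlpos t
    have h1 : l t * (1 + p' t ^ 2 + p t ^ 2) ≤ l t * (2 * p t * (p'' t + p t)) :=
      mul_le_mul_of_nonneg_left (hineq t) hlt.le
    have h2 : 2 * p t * l t * (l t * p'' t - l' t * p' t + A * p t)
        ≥ 2 * p t * l t := by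
      have h3 : l t * (l t * (1 + p' t ^ 2 + p t ^ 2)) ≤ l t * (l t * (2 * p t * (p'' t + p t))) :=
        mul_le_mul_of_nonneg_left h1 hlt.le
      have h4 := hlid t
      have h5 : p t ^ 2 * (l t * (2 * A - l t)) = p t ^ 2 * (1 + l' t ^ 2) := by rw [h4]
      nlinarith [sq_nonneg (l t * p' t - p t * l' t), sq_nonneg (l t - p t)]
    have h6 : 0 < 2 * p t * l t := by positivity
    by_contra hcon
    push Not at hcon
    nlinarith
  -- The Wronskian of `p - l` and `χ`, divided by `l`. As `L χ = 0` (from `ha`) and `L l = 1` (from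
  -- `hl`), its derivative is `χ L (p - l) / l²`. At `T`, where `χ` vanishes, its sign decides the
  -- sign of `p - l`.
  set W : ℝ → ℝ := fun t => ((p' t - l' t) * χ t - (p t - l t) * χ' t) / l t with hW
  have hWder : ∀ t, HasDerivAt W
      (χ t * (l t * p'' t - l' t * p' t + A * p t - 1) / l t ^ 2) t := by
    intro t
    have e1 := (((hp' t).sub (hder' b c t)).mul (hder a₀ a₁ a₂ t)).sub
      (((hp t).sub (hder A b c t)).mul (hder' a₁ a₂ t))
    have e2 := e1.div (hder A b c t) (hlpos t).ne'
    refine e2.congr_deriv ?_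
    have hlt := (hlpos t).ne'
    simp only [Pi.sub_apply, Pi.mul_apply]
    congr 1
    simp only [hldef, hl'def, hχdef]
    have h7 := Real.sin_sq_add_cos_sq t
    generalize Real.sin t = S at *
    generalize Real.cos t = C at *
    generalize p t = P
    generalize p' t = P'
    generalize p'' t = P''
    linear_combination
      (a₀ + a₁ * C + a₂ * S) * (-hl + (b ^ 2 + c ^ 2) * h7)
        - (P - (A + b * C + c * S)) * (ha - (b * a₁ + c * a₂) * h7)
  have hmono : MonotoneOn W (Set.Icc 0 T) := by
    apply monotoneOn_of_deriv_nonneg (convex_Icc 0 T)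
    · exact fun t _ => (hWder t).continuousAt.continuousWithinAt
    · exact fun t _ => (hWder t).differentiableAt.differentiableWithinAt
    · intro t ht
      rw [interior_Icc] at ht
      rw [(hWder t).deriv]
      apply div_nonneg _ (sq_nonneg _)
      exact mul_nonneg (hχ t ⟨ht.1.le, ht.2.le⟩) (by linarith [hlin t])
  have hfin := hmono ⟨le_rfl, hT⟩ ⟨hT, le_rfl⟩ hT
  have hW0 : W 0 = 0 := by simp [hW, hldef, hl'def, h0, h0']
  have hWT : W T = -(p T - l T) * χ' T / l T := by
    have : χ T = 0 := hχT
    simp only [hW, this]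
    ring
  rw [hW0, hWT] at hfin
  by_contra hcon
  push Not at hcon
  have h8 : -(p T - l T) * χ' T / l T < 0 := by
    apply div_neg_of_neg_of_pos _ (hlpos T)
    have : 0 < -(p T - l T) := by simp only [hldef]; linarith
    exact mul_neg_of_pos_of_neg this hχT'
  linarith

end HypChristoffel

namespace HypChristoffel
open Filter Topology

set_option maxSynthPendingDepth 5
set_option synthInstance.maxHeartbeats 200000

/-! ### Derivatives along lines and symmetry of higher derivatives -/

section Derivatives

variable {E F : Type*} [NormedAddCommGroup E] [NormedSpace ℝ E]
  [NormedAddCommGroup F] [NormedSpace ℝ F]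

theorem hasDerivAt_along_line {G : E → F} {x l : E} {t : ℝ}
    (hG : DifferentiableAt ℝ G (x + t • l)) :
    HasDerivAt (fun s : ℝ => G (x + s • l)) (fderiv ℝ G (x + t • l) l) t := by
  have h : HasDerivAt (fun s : ℝ => x + s • l) l t := by
    simpa using ((hasDerivAt_id t).smul_const l).const_add x
  exact hG.hasFDerivAt.comp_hasDerivAt t h

theorem hasDerivAt_along_line_apply {G : E → E →L[ℝ] F} {x l : E} (v : E) {t : ℝ}
    (hG : DifferentiableAt ℝ G (x + t • l)) :
    HasDerivAt (fun s : ℝ => G (x + s • l) v) (fderiv ℝ G (x + t • l) l v) t := by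
  simpa using (hasDerivAt_along_line hG).clm_apply (hasDerivAt_const t v)

theorem hasDerivAt_along_line_apply₂ {G : E → E →L[ℝ] E →L[ℝ] F} {x l : E} (v w : E) {t : ℝ}
    (hG : DifferentiableAt ℝ G (x + t • l)) :
    HasDerivAt (fun s : ℝ => G (x + s • l) v w) (fderiv ℝ G (x + t • l) l v w) t := by
  simpa using (hasDerivAt_along_line_apply v hG).clm_apply (hasDerivAt_const t w)

theorem hasDerivAt_along_line_apply₃ {G : E → E →L[ℝ] E →L[ℝ] E →L[ℝ] F} {x l : E}
    (u v w : E) {t : ℝ} (hG : DifferentiableAt ℝ G (x + t • l)) :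
    HasDerivAt (fun s : ℝ => G (x + s • l) u v w) (fderiv ℝ G (x + t • l) l u v w) t := by
  simpa using (hasDerivAt_along_line_apply₂ u v hG).clm_apply (hasDerivAt_const t w)

theorem eventually_along_line {p : E → Prop} {x : E} (l : E) (h : ∀ᶠ y in 𝓝 x, p y) :
    ∀ᶠ t : ℝ in 𝓝 0, p (x + t • l) := by
  have hc : ContinuousAt (fun t : ℝ => x + t • l) 0 := by fun_prop
  have : Tendsto (fun t : ℝ => x + t • l) (𝓝 0) (𝓝 x) := by
    simpa [ContinuousAt] using hc
  exact this.eventually h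

theorem snd_fderiv_symm {G : E → F} {x : E} (h : ContDiffAt ℝ 2 G x) (v w : E) :
    fderiv ℝ (fderiv ℝ G) x v w = fderiv ℝ (fderiv ℝ G) x w v :=
  (h.isSymmSndFDerivAt (by simp)) v w

theorem eventually_differentiableAt_of_contDiffAt_four {Φ : E → ℝ} {x : E}
    (h : ContDiffAt ℝ 4 Φ x) :
    ∀ᶠ y in 𝓝 x, ContDiffAt ℝ 4 Φ y ∧ ContDiffAt ℝ 3 (fderiv ℝ Φ) y ∧
      ContDiffAt ℝ 2 (fderiv ℝ (fderiv ℝ Φ)) y ∧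
      ContDiffAt ℝ 1 (fderiv ℝ (fderiv ℝ (fderiv ℝ Φ))) y := by
  filter_upwards [h.eventually (by simp)] with y hy
  have h1 : ContDiffAt ℝ 3 (fderiv ℝ Φ) y := hy.fderiv_right (by norm_num)
  have h2 : ContDiffAt ℝ 2 (fderiv ℝ (fderiv ℝ Φ)) y := h1.fderiv_right (by norm_num)
  exact ⟨hy, h1, h2, h2.fderiv_right (by norm_num)⟩

theorem third_fderiv_swap_left {Φ : E → ℝ} {x : E} (h : ContDiffAt ℝ 4 Φ x) (u v w : E) :
    fderiv ℝ (fderiv ℝ (fderiv ℝ Φ)) x u v w = fderiv ℝ (fderiv ℝ (fderiv ℝ Φ)) x v u w := by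
  have h1 := (eventually_differentiableAt_of_contDiffAt_four h).self_of_nhds.2.1
  rw [snd_fderiv_symm (h1.of_le (by norm_num))]

/-- The symmetry of the second derivative holds on a neighbourhood, so it can be differentiated. -/
theorem third_fderiv_swap_right {Φ : E → ℝ} {x : E} (h : ContDiffAt ℝ 4 Φ x) (u v w : E) :
    fderiv ℝ (fderiv ℝ (fderiv ℝ Φ)) x u v w = fderiv ℝ (fderiv ℝ (fderiv ℝ Φ)) x u w v := by
  have hev := eventually_differentiableAt_of_contDiffAt_four h
  have hd : DifferentiableAt ℝ (fderiv ℝ (fderiv ℝ Φ)) (x + (0 : ℝ) • u) := by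
    simpa using hev.self_of_nhds.2.2.1.differentiableAt (by norm_num)
  have e1 := hasDerivAt_along_line_apply₂ v w hd
  have e2 := hasDerivAt_along_line_apply₂ w v hd
  have : (fun s : ℝ => fderiv ℝ (fderiv ℝ Φ) (x + s • u) v w) =ᶠ[𝓝 0]
      fun s : ℝ => fderiv ℝ (fderiv ℝ Φ) (x + s • u) w v := by
    filter_upwards [eventually_along_line u hev] with s hs
    exact snd_fderiv_symm (hs.1.of_le (by norm_num)) v w
  have := e1.unique (e2.congr_of_eventuallyEq this)
  simpa using this

theorem fourth_fderiv_swap {Φ : E → ℝ} {x : E} (h : ContDiffAt ℝ 4 Φ x) (l e : E) :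
    fderiv ℝ (fderiv ℝ (fderiv ℝ (fderiv ℝ Φ))) x l l e e
      = fderiv ℝ (fderiv ℝ (fderiv ℝ (fderiv ℝ Φ))) x e e l l := by
  have hev := eventually_differentiableAt_of_contDiffAt_four h
  have hd : ∀ a : E, DifferentiableAt ℝ (fderiv ℝ (fderiv ℝ (fderiv ℝ Φ))) (x + (0 : ℝ) • a) := by
    intro a
    simpa using hev.self_of_nhds.2.2.2.differentiableAt (by norm_num)
  have s12 : ∀ a b u v : E, fderiv ℝ (fderiv ℝ (fderiv ℝ (fderiv ℝ Φ))) x a b u v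
      = fderiv ℝ (fderiv ℝ (fderiv ℝ (fderiv ℝ Φ))) x b a u v := by
    intro a b u v
    rw [snd_fderiv_symm hev.self_of_nhds.2.2.1]
  have s23 : ∀ a b u v : E, fderiv ℝ (fderiv ℝ (fderiv ℝ (fderiv ℝ Φ))) x a b u v
      = fderiv ℝ (fderiv ℝ (fderiv ℝ (fderiv ℝ Φ))) x a u b v := by
    intro a b u v
    have : (fun s : ℝ => fderiv ℝ (fderiv ℝ (fderiv ℝ Φ)) (x + s • a) b u v) =ᶠ[𝓝 0]
        fun s : ℝ => fderiv ℝ (fderiv ℝ (fderiv ℝ Φ)) (x + s • a) u b v := by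
      filter_upwards [eventually_along_line a hev] with s hs
      exact third_fderiv_swap_left hs.1 b u v
    have := (hasDerivAt_along_line_apply₃ b u v (hd a)).unique
      ((hasDerivAt_along_line_apply₃ u b v (hd a)).congr_of_eventuallyEq this)
    simpa using this
  have s34 : ∀ a b u v : E, fderiv ℝ (fderiv ℝ (fderiv ℝ (fderiv ℝ Φ))) x a b u v
      = fderiv ℝ (fderiv ℝ (fderiv ℝ (fderiv ℝ Φ))) x a b v u := by
    intro a b u v
    have : (fun s : ℝ => fderiv ℝ (fderiv ℝ (fderiv ℝ Φ)) (x + s • a) b u v) =ᶠ[𝓝 0]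
        fun s : ℝ => fderiv ℝ (fderiv ℝ (fderiv ℝ Φ)) (x + s • a) b v u := by
      filter_upwards [eventually_along_line a hev] with s hs
      exact third_fderiv_swap_right hs.1 b u v
    have := (hasDerivAt_along_line_apply₃ b u v (hd a)).unique
      ((hasDerivAt_along_line_apply₃ b v u (hd a)).congr_of_eventuallyEq this)
    simpa using this
  -- Adjacent transpositions: `llee → lele → elle → elel → eell`.
  rw [s23, s12, s34, s23]

end Derivatives

/-! ### The form and the equation, differentiated at a null vector -/

section NullPoint

variable {E ι : Type*} [NormedAddCommGroup E] [InnerProductSpace ℝ E] [Fintype ι]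

/-- The squared norm of the gradient, in an orthonormal basis. -/
noncomputable def gradSq (b : OrthonormalBasis ι ℝ E) (Φ : E → ℝ) (y : E) : ℝ :=
  ∑ j, fderiv ℝ Φ y (b j) ^ 2

/-- The directional derivative of `gradSq`. -/
noncomputable def gradSqDeriv (b : OrthonormalBasis ι ℝ E) (Φ : E → ℝ) (y l : E) : ℝ :=
  ∑ j, 2 * (fderiv ℝ Φ y (b j) * fderiv ℝ (fderiv ℝ Φ) y l (b j))

/-- The second directional derivative of `gradSq`. -/
noncomputable def gradSqDeriv₂ (b : OrthonormalBasis ι ℝ E) (Φ : E → ℝ) (y l : E) : ℝ :=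
  ∑ j, 2 * (fderiv ℝ (fderiv ℝ Φ) y l (b j) ^ 2
    + fderiv ℝ Φ y (b j) * fderiv ℝ (fderiv ℝ (fderiv ℝ Φ)) y l l (b j))

/-- The Laplacian in an orthonormal basis. -/
noncomputable def flatLap (b : OrthonormalBasis ι ℝ E) (Φ : E → ℝ) (y : E) : ℝ :=
  ∑ j, fderiv ℝ (fderiv ℝ Φ) y (b j) (b j)

theorem hasDerivAt_gradSq (b : OrthonormalBasis ι ℝ E) {Φ : E → ℝ} {x l : E} {t : ℝ}
    (h : DifferentiableAt ℝ (fderiv ℝ Φ) (x + t • l)) :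
    HasDerivAt (fun s : ℝ => gradSq b Φ (x + s • l)) (gradSqDeriv b Φ (x + t • l) l) t := by
  unfold gradSq gradSqDeriv
  refine HasDerivAt.fun_sum fun j _ => ?_
  exact ((hasDerivAt_along_line_apply (b j) h).fun_pow 2).congr_deriv (by ring)

theorem hasDerivAt_gradSqDeriv (b : OrthonormalBasis ι ℝ E) {Φ : E → ℝ} {x l : E} {t : ℝ}
    (h : DifferentiableAt ℝ (fderiv ℝ Φ) (x + t • l))
    (h' : DifferentiableAt ℝ (fderiv ℝ (fderiv ℝ Φ)) (x + t • l)) :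
    HasDerivAt (fun s : ℝ => gradSqDeriv b Φ (x + s • l) l)
      (gradSqDeriv₂ b Φ (x + t • l) l) t := by
  unfold gradSqDeriv gradSqDeriv₂
  refine HasDerivAt.fun_sum fun j _ => ?_
  exact (((hasDerivAt_along_line_apply (b j) h).fun_mul
    (hasDerivAt_along_line_apply₂ l (b j) h')).const_mul 2).congr_deriv (by ring)

/-- First and second order conditions at a null vector `e` of the quadratic form
`2 Φ D²Φ(v, v) - (1 + |∇Φ|²) (|v|² - ⟪v, y⟫² / |y|²)`. -/
theorem null_vector_conditions (b : OrthonormalBasis ι ℝ E) {Φ : E → ℝ} {x e : E}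
    (hΦ : ContDiffAt ℝ 4 Φ x) (hx : ‖x‖ = 1) (he : ‖e‖ = 1) (hex : ⟪e, x⟫ = 0)
    (hQ : ∀ᶠ y in 𝓝 x, ∀ v, (1 + gradSq b Φ y) * (‖v‖ ^ 2 - ⟪v, y⟫ ^ 2 / ‖y‖ ^ 2)
      ≤ 2 * Φ y * fderiv ℝ (fderiv ℝ Φ) y v v)
    (hnull : ∀ v, 2 * Φ x * fderiv ℝ (fderiv ℝ Φ) x e v = (1 + gradSq b Φ x) * ⟪e, v⟫)
    (l ξ : E) :
    2 * (fderiv ℝ Φ x l * fderiv ℝ (fderiv ℝ Φ) x e e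
        + Φ x * fderiv ℝ (fderiv ℝ (fderiv ℝ Φ)) x l e e) - gradSqDeriv b Φ x l = 0 ∧
    0 ≤ (2 * (fderiv ℝ (fderiv ℝ Φ) x l l * fderiv ℝ (fderiv ℝ Φ) x e e
          + 2 * fderiv ℝ Φ x l * fderiv ℝ (fderiv ℝ (fderiv ℝ Φ)) x l e e
          + Φ x * fderiv ℝ (fderiv ℝ (fderiv ℝ (fderiv ℝ Φ))) x l l e e)
          - gradSqDeriv₂ b Φ x l)
      + 4 * (2 * (fderiv ℝ Φ x l * fderiv ℝ (fderiv ℝ Φ) x e ξ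
          + Φ x * fderiv ℝ (fderiv ℝ (fderiv ℝ Φ)) x l e ξ)
          - gradSqDeriv b Φ x l * ⟪e, ξ⟫)
      + 2 * (2 * Φ x * fderiv ℝ (fderiv ℝ Φ) x ξ ξ - (1 + gradSq b Φ x) * ‖ξ‖ ^ 2
          + (1 + gradSq b Φ x) * (⟪ξ, x⟫ + ⟪e, l⟫) ^ 2) := by
  have hev := eventually_differentiableAt_of_contDiffAt_four hΦ
  have hevl := eventually_along_line l hev
  have h0 := hevl.self_of_nhds
  have d0 := h0.1.differentiableAt (by norm_num)
  have d1 := h0.2.1.differentiableAt (by norm_num)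
  have d2 := h0.2.2.1.differentiableAt (by norm_num)
  have d3 := h0.2.2.2.differentiableAt (by norm_num)
  -- This expands the form at `x + t l` on `e + t ξ` in powers of the explicit `t`. Only `α` is
  -- differentiated twice, so four derivatives of `Φ` suffice. Because `e ⟂ x`, the inner product
  -- `⟪e + t ξ, x + t l⟫` has a factor `t`, and the projection term goes entirely into `γ`.
  have key := second_order_conditions
    (α := fun t => 2 * (Φ (x + t • l) * fderiv ℝ (fderiv ℝ Φ) (x + t • l) e e)
      - (1 + gradSq b Φ (x + t • l)))
    (α' := fun t => 2 * (fderiv ℝ Φ (x + t • l) l * fderiv ℝ (fderiv ℝ Φ) (x + t • l) e e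
      + Φ (x + t • l) * fderiv ℝ (fderiv ℝ (fderiv ℝ Φ)) (x + t • l) l e e)
      - gradSqDeriv b Φ (x + t • l) l)
    (β := fun t => 2 * (Φ (x + t • l) * fderiv ℝ (fderiv ℝ Φ) (x + t • l) e ξ)
      - (1 + gradSq b Φ (x + t • l)) * ⟪e, ξ⟫)
    (γ := fun t => 2 * (Φ (x + t • l) * fderiv ℝ (fderiv ℝ Φ) (x + t • l) ξ ξ)
      - (1 + gradSq b Φ (x + t • l)) * ‖ξ‖ ^ 2
      + (1 + gradSq b Φ (x + t • l)) * (⟪ξ, x + t • l⟫ + ⟪e, l⟫) ^ 2 / ‖x + t • l‖ ^ 2)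
    ?_
    ((((hasDerivAt_along_line_apply l d1).fun_mul (hasDerivAt_along_line_apply₂ e e d2)).fun_add
      ((hasDerivAt_along_line d0).fun_mul (hasDerivAt_along_line_apply₃ l e e d3))).const_mul 2
      |>.fun_sub (hasDerivAt_gradSqDeriv b d1 d2))
    ((((hasDerivAt_along_line d0).fun_mul (hasDerivAt_along_line_apply₂ e ξ d2)).const_mul 2).fun_sub
      (((hasDerivAt_gradSq b d1).const_add 1).mul_const ⟪e, ξ⟫))
    ?_ ?_ ?_ ?_
  · simp only [zero_smul, add_zero, hx, one_pow, div_one] at key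
    refine ⟨key.1, key.2.trans_eq ?_⟩
    ring
  · filter_upwards [hevl] with t ht
    have d0 := ht.1.differentiableAt (by norm_num)
    have d1 := ht.2.1.differentiableAt (by norm_num)
    have d2 := ht.2.2.1.differentiableAt (by norm_num)
    exact (((hasDerivAt_along_line d0).fun_mul
      (hasDerivAt_along_line_apply₂ e e d2)).const_mul 2).fun_sub
      ((hasDerivAt_gradSq b d1).const_add 1)
  · have c0 := (hasDerivAt_along_line d0).continuousAt
    have c2 := (hasDerivAt_along_line_apply₂ ξ ξ d2).continuousAt
    have cN := (hasDerivAt_gradSq b d1).continuousAt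
    have cy : ContinuousAt (fun t : ℝ => x + t • l) 0 := by fun_prop
    refine ((((c0.mul c2).const_mul 2)).sub ((cN.const_add 1).mul_const _)).add ?_
    refine ContinuousAt.div ((cN.const_add 1).mul ?_) (cy.norm.pow 2) (by simp [hx])
    exact ((continuousAt_const.inner cy).add_const _).pow 2
  · have := hnull e
    simp only [real_inner_self_eq_norm_sq, he] at this
    simp only [zero_smul, add_zero]
    linarith
  · have := hnull ξ
    simp only [zero_smul, add_zero]
    linarith
  · filter_upwards [eventually_along_line l hQ, hevl] with t ht hd
    have h := ht (e + t • ξ)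
    have hs := snd_fderiv_symm (hd.1.of_le (by norm_num)) ξ e
    have i1 : ‖e + t • ξ‖ ^ 2 = 1 + 2 * t * ⟪e, ξ⟫ + t ^ 2 * ‖ξ‖ ^ 2 := by
      rw [norm_add_sq_real, he, real_inner_smul_right, norm_smul, mul_pow, Real.norm_eq_abs, sq_abs]
      ring
    have i2 : ⟪e + t • ξ, x + t • l⟫ = t * (⟪ξ, x + t • l⟫ + ⟪e, l⟫) := by
      rw [inner_add_left, real_inner_smul_left, inner_add_right e, hex, real_inner_smul_right]
      ring
    rw [i1, i2] at h
    simp only [map_add, map_smul, _root_.add_apply, _root_.smul_apply,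
      smul_eq_mul, hs] at h
    refine (sub_nonneg.mpr h).trans_eq ?_
    ring

/-- The equation `2 Φ ΔΦ - n |∇Φ|² = 2 / g + n`, differentiated once and twice in a direction. -/
theorem equation_derivatives (b : OrthonormalBasis ι ℝ E) {Φ g : E → ℝ} {x : E} {n : ℝ}
    (hΦ : ContDiffAt ℝ 4 Φ x) (hg : ContDiffAt ℝ 2 g x) (hgx : g x ≠ 0)
    (heq : ∀ᶠ y in 𝓝 x, 2 * Φ y * flatLap b Φ y - n * gradSq b Φ y = 2 * (g y)⁻¹ + n)
    (u : E) :
    2 * (fderiv ℝ Φ x u * flatLap b Φ x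
        + Φ x * ∑ j, fderiv ℝ (fderiv ℝ (fderiv ℝ Φ)) x u (b j) (b j))
        - n * gradSqDeriv b Φ x u = 2 * (-fderiv ℝ g x u / g x ^ 2) ∧
    2 * (fderiv ℝ (fderiv ℝ Φ) x u u * flatLap b Φ x
        + 2 * fderiv ℝ Φ x u * ∑ j, fderiv ℝ (fderiv ℝ (fderiv ℝ Φ)) x u (b j) (b j)
        + Φ x * ∑ j, fderiv ℝ (fderiv ℝ (fderiv ℝ (fderiv ℝ Φ))) x u u (b j) (b j))
        - n * gradSqDeriv₂ b Φ x u
      = 2 * (-fderiv ℝ (fderiv ℝ g) x u u / g x ^ 2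
          + 2 * fderiv ℝ g x u ^ 2 / g x ^ 3) := by
  have hev := eventually_differentiableAt_of_contDiffAt_four hΦ
  have hgev : ∀ᶠ y in 𝓝 x, ContDiffAt ℝ 2 g y ∧ g y ≠ 0 :=
    (hg.eventually (by simp)).and (hg.continuousAt.eventually_ne hgx)
  have hL : ∀ {t : ℝ}, DifferentiableAt ℝ (fderiv ℝ (fderiv ℝ Φ)) (x + t • u) →
      HasDerivAt (fun s : ℝ => flatLap b Φ (x + s • u))
        (∑ j, fderiv ℝ (fderiv ℝ (fderiv ℝ Φ)) (x + t • u) u (b j) (b j)) t := by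
    intro t ht
    exact HasDerivAt.fun_sum fun j _ => hasDerivAt_along_line_apply₂ (b j) (b j) ht
  have hfirst : ∀ᶠ t : ℝ in 𝓝 0,
      2 * (fderiv ℝ Φ (x + t • u) u * flatLap b Φ (x + t • u)
        + Φ (x + t • u) * ∑ j, fderiv ℝ (fderiv ℝ (fderiv ℝ Φ)) (x + t • u) u (b j) (b j))
        - n * gradSqDeriv b Φ (x + t • u) u
        = 2 * (-fderiv ℝ g (x + t • u) u / g (x + t • u) ^ 2) := by
    filter_upwards [eventually_along_line u hev, eventually_along_line u hgev,
      (eventually_along_line u heq).eventually_nhds] with t ht hgt heqt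
    have d0 := ht.1.differentiableAt (by norm_num)
    have d1 := ht.2.1.differentiableAt (by norm_num)
    have d2 := ht.2.2.1.differentiableAt (by norm_num)
    have dg := hgt.1.differentiableAt (by norm_num)
    have e1 := (((hasDerivAt_along_line d0).const_mul 2).fun_mul (hL d2)).fun_sub
      ((hasDerivAt_gradSq b d1).const_mul n)
    have e2 := (((hasDerivAt_along_line dg).fun_inv hgt.2).const_mul 2).add_const n
    have := e1.unique (e2.congr_of_eventuallyEq heqt)
    linarith
  refine ⟨by simpa using hfirst.self_of_nhds, ?_⟩
  have h0 := (eventually_along_line u hev).self_of_nhds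
  have d0 := h0.1.differentiableAt (by norm_num)
  have d1 := h0.2.1.differentiableAt (by norm_num)
  have d2 := h0.2.2.1.differentiableAt (by norm_num)
  have d3 := h0.2.2.2.differentiableAt (by norm_num)
  have hg0 := (eventually_along_line u hgev).self_of_nhds
  have dg0 := hg0.1.differentiableAt (by norm_num)
  have dg1 := (hg0.1.fderiv_right (m := 1) (by norm_num)).differentiableAt (by norm_num)
  have hL' : HasDerivAt
      (fun s : ℝ => ∑ j, fderiv ℝ (fderiv ℝ (fderiv ℝ Φ)) (x + s • u) u (b j) (b j))
      (∑ j, fderiv ℝ (fderiv ℝ (fderiv ℝ (fderiv ℝ Φ))) (x + (0 : ℝ) • u) u u (b j) (b j)) 0 :=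
    HasDerivAt.fun_sum fun j _ => hasDerivAt_along_line_apply₃ u (b j) (b j) d3
  have e1 := ((((hasDerivAt_along_line_apply u d1).fun_mul (hL d2)).fun_add
    ((hasDerivAt_along_line d0).fun_mul hL')).const_mul 2).fun_sub
    ((hasDerivAt_gradSqDeriv b d1 d2).const_mul n)
  have e2 := (((hasDerivAt_along_line_apply u dg1).fun_neg).fun_div
    ((hasDerivAt_along_line dg0).fun_pow 2) (pow_ne_zero 2 hg0.2)).const_mul 2
  have := e1.unique (e2.congr_of_eventuallyEq hfirst)
  simp only [zero_smul, add_zero] at this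
  have hr : ∀ a c G : ℝ, G ≠ 0 →
      2 * ((-a * G ^ 2 - -c * (((2 : ℕ) : ℝ) * G ^ (2 - 1) * c)) / (G ^ 2) ^ 2)
        = 2 * (-a / G ^ 2 + 2 * c ^ 2 / G ^ 3) := by
    intro a c G hG
    field_simp
    push_cast
    ring
  linear_combination this + hr (fderiv ℝ (fderiv ℝ g) x u u) (fderiv ℝ g x u) (g x) hgx

end NullPoint
end HypChristoffel

namespace HypChristoffel
open Filter Topology

set_option maxSynthPendingDepth 5
set_option synthInstance.maxHeartbeats 200000

/-! ### The differential inequality for `1 / f` at a null point -/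

section NullPoint

variable {E ι : Type*} [NormedAddCommGroup E] [InnerProductSpace ℝ E] [Fintype ι]

theorem sum_inner_mul_apply (b : OrthonormalBasis ι ℝ E) (M : E →L[ℝ] ℝ) (v : E) :
    ∑ i, ⟪b i, v⟫ * M (b i) = M v := by
  conv_rhs => rw [← b.sum_repr' v]
  simp

theorem sum_inner_sq (b : OrthonormalBasis ι ℝ E) (v : E) : ∑ i, ⟪b i, v⟫ ^ 2 = ‖v‖ ^ 2 := by
  rw [← real_inner_self_eq_norm_sq, ← b.sum_inner_mul_inner v v]
  exact Finset.sum_congr rfl fun i _ => by rw [real_inner_comm v, sq]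

/-- The gradient of `Φ` at `x`, in an orthonormal basis. -/
noncomputable def basisGrad (b : OrthonormalBasis ι ℝ E) (Φ : E → ℝ) (x : E) : E :=
  ∑ i, fderiv ℝ Φ x (b i) • b i

theorem inner_basisGrad (b : OrthonormalBasis ι ℝ E) (Φ : E → ℝ) (x v : E) :
    ⟪basisGrad b Φ x, v⟫ = fderiv ℝ Φ x v := by
  rw [basisGrad, sum_inner, ← sum_inner_mul_apply b (fderiv ℝ Φ x) v]
  exact Finset.sum_congr rfl fun i _ => by rw [real_inner_smul_left, mul_comm]

theorem sum_fderiv_mul_apply (b : OrthonormalBasis ι ℝ E) (Φ : E → ℝ) (x : E) (M : E →L[ℝ] ℝ) :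
    ∑ i, fderiv ℝ Φ x (b i) * M (b i) = M (basisGrad b Φ x) := by
  simp [basisGrad]

theorem gradSq_eq (b : OrthonormalBasis ι ℝ E) (Φ : E → ℝ) (x : E) :
    gradSq b Φ x = ‖basisGrad b Φ x‖ ^ 2 := by
  rw [← sum_inner_sq b, gradSq]
  exact Finset.sum_congr rfl fun i _ => by rw [real_inner_comm, inner_basisGrad]

theorem gradSqDeriv_eq (b : OrthonormalBasis ι ℝ E) (Φ : E → ℝ) (x l : E) :
    gradSqDeriv b Φ x l = 2 * fderiv ℝ (fderiv ℝ Φ) x l (basisGrad b Φ x) := by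
  rw [gradSqDeriv, ← Finset.mul_sum, sum_fderiv_mul_apply]

theorem gradSqDeriv₂_eq (b : OrthonormalBasis ι ℝ E) (Φ : E → ℝ) (x l : E) :
    gradSqDeriv₂ b Φ x l = 2 * ∑ j, fderiv ℝ (fderiv ℝ Φ) x l (b j) ^ 2
      + 2 * fderiv ℝ (fderiv ℝ (fderiv ℝ Φ)) x l l (basisGrad b Φ x) := by
  rw [gradSqDeriv₂, ← Finset.mul_sum, Finset.sum_add_distrib, sum_fderiv_mul_apply, mul_add]

/-- `|H - A P|² ≥ 0`, where `P` is the projection to `x^⊥` and `H x = 0`. -/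
theorem hessian_sq_lower_bound (b : OrthonormalBasis ι ℝ E) (H : E →L[ℝ] E →L[ℝ] ℝ) {x : E}
    {n : ℝ} (hcard : (Fintype.card ι : ℝ) = n + 1) (hx : ‖x‖ = 1)
    (hH : ∀ v, H v x = 0) (A : ℝ) :
    2 * A * ∑ i, H (b i) (b i) - n * A ^ 2 ≤ ∑ i, ∑ j, H (b i) (b j) ^ 2 := by
  classical
  have h1 : ∀ i, ∑ j, (H (b i) (b j) - A * (⟪b i, b j⟫ - ⟪b i, x⟫ * ⟪b j, x⟫)) ^ 2
      = ∑ j, H (b i) (b j) ^ 2 - 2 * A * H (b i) (b i)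
        + A ^ 2 * (1 - ⟪b i, x⟫ ^ 2) := by
    intro i
    have e1 : ∑ j, ⟪b j, b i⟫ * H (b i) (b j) = H (b i) (b i) := sum_inner_mul_apply b (H (b i)) _
    have e2 : ∑ j, ⟪b j, x⟫ * H (b i) (b j) = 0 := by
      rw [sum_inner_mul_apply b (H (b i)) x, hH]
    have e3 : ∑ j, ⟪b j, b i⟫ ^ 2 = 1 := by simp [sum_inner_sq]
    have e4 : ∑ j, ⟪b j, x⟫ ^ 2 = 1 := by simp [sum_inner_sq, hx]
    have e5 : ∑ j, ⟪b j, b i⟫ * ⟪b j, x⟫ = ⟪b i, x⟫ := by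
      rw [← b.sum_inner_mul_inner (b i) x]
      exact Finset.sum_congr rfl fun j _ => by rw [real_inner_comm (b i)]
    have : ∀ j, (H (b i) (b j) - A * (⟪b i, b j⟫ - ⟪b i, x⟫ * ⟪b j, x⟫)) ^ 2
        = H (b i) (b j) ^ 2 - (2 * A) * (⟪b j, b i⟫ * H (b i) (b j))
          + (2 * A * ⟪b i, x⟫) * (⟪b j, x⟫ * H (b i) (b j))
          + A ^ 2 * ⟪b j, b i⟫ ^ 2 - (2 * A ^ 2 * ⟪b i, x⟫) * (⟪b j, b i⟫ * ⟪b j, x⟫)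
          + (A ^ 2 * ⟪b i, x⟫ ^ 2) * ⟪b j, x⟫ ^ 2 := by
      intro j
      rw [real_inner_comm (b i) (b j)]
      ring
    simp only [this, Finset.sum_add_distrib, Finset.sum_sub_distrib, ← Finset.mul_sum, e1, e2, e3,
      e4, e5]
    ring
  have h2 : 0 ≤ ∑ i, ∑ j, (H (b i) (b j) - A * (⟪b i, b j⟫ - ⟪b i, x⟫ * ⟪b j, x⟫)) ^ 2 :=
    Finset.sum_nonneg fun i _ => Finset.sum_nonneg fun j _ => sq_nonneg _
  simp only [h1, Finset.sum_add_distrib, Finset.sum_sub_distrib, ← Finset.mul_sum] at h2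
  rw [sum_inner_sq, hx, Finset.sum_const, Finset.card_univ, nsmul_eq_mul, hcard] at h2
  linarith

/-- The differential inequality for `g = 1 / f` at a point where the quadratic form
`2 Φ D²Φ(v, v) - (1 + |∇Φ|²) (|v|² - ⟪v, y⟫² / |y|²)` has a null vector. -/
theorem null_point_inequality (b : OrthonormalBasis ι ℝ E) {Φ g : E → ℝ} {x e : E} {n : ℝ}
    (hcard : (Fintype.card ι : ℝ) = n + 1)
    (hΦ : ContDiffAt ℝ 4 Φ x) (hg : ContDiffAt ℝ 2 g x) (hΦx : 0 < Φ x) (hgx : 0 < g x)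
    (hx : ‖x‖ = 1) (he : ‖e‖ = 1) (hex : ⟪e, x⟫ = 0)
    (hE1 : fderiv ℝ Φ x x = Φ x) (hE2 : ∀ v, fderiv ℝ (fderiv ℝ Φ) x v x = 0)
    (hQ : ∀ᶠ y in 𝓝 x, ∀ v, (1 + gradSq b Φ y) * (‖v‖ ^ 2 - ⟪v, y⟫ ^ 2 / ‖y‖ ^ 2)
      ≤ 2 * Φ y * fderiv ℝ (fderiv ℝ Φ) y v v)
    (heq : ∀ᶠ y in 𝓝 x, 2 * Φ y * flatLap b Φ y - n * gradSq b Φ y = 2 * (g y)⁻¹ + n)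
    (hnull : ∀ v, 2 * Φ x * fderiv ℝ (fderiv ℝ Φ) x e v = (1 + gradSq b Φ x) * ⟪e, v⟫) :
    0 ≤ -fderiv ℝ (fderiv ℝ g) x e e / g x ^ 2
      + (fderiv ℝ g x (basisGrad b Φ x) - 2 * fderiv ℝ g x e * fderiv ℝ Φ x e) / (g x ^ 2 * Φ x)
      - 1 / (g x * Φ x ^ 2) := by
  have hcond := null_vector_conditions b hΦ hx he hex hQ hnull
  have heqd := equation_derivatives b hΦ hg hgx.ne' heq
  have heq0 := heq.self_of_nhds
  have hswap : ∀ i, fderiv ℝ (fderiv ℝ (fderiv ℝ (fderiv ℝ Φ))) x (b i) (b i) e e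
      = fderiv ℝ (fderiv ℝ (fderiv ℝ (fderiv ℝ Φ))) x e e (b i) (b i) :=
    fun i => fourth_fderiv_swap hΦ (b i) e
  have hT1 := third_fderiv_swap_left hΦ
  have hT2 := third_fderiv_swap_right hΦ
  have hsym := snd_fderiv_symm (hΦ.of_le (by norm_num) : ContDiffAt ℝ 2 Φ x)
  have hug := inner_basisGrad b Φ x
  have hN := gradSq_eq b Φ x
  have hNu : fderiv ℝ Φ x (basisGrad b Φ x) = gradSq b Φ x := by
    rw [← hug, hN, real_inner_self_eq_norm_sq]
  simp only [gradSqDeriv_eq, gradSqDeriv₂_eq] at hcond heqd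
  have hsumD1 := fun M => sum_fderiv_mul_apply b Φ x M
  -- With this constant, `H - A P` is `U[φ]` extended by zero in the direction of `x` when `Φ` is
  -- the extension of `φ`; the square discarded below is then `|U[φ]|²`.
  have hlow := hessian_sq_lower_bound b (fderiv ℝ (fderiv ℝ Φ) x) hcard hx hE2
    ((1 + gradSq b Φ x) / (2 * Φ x))
  unfold flatLap at heqd heq0
  set u := basisGrad b Φ x with hu
  set N := gradSq b Φ x
  set P := Φ x
  generalize fderiv ℝ (fderiv ℝ (fderiv ℝ (fderiv ℝ Φ))) x = D4 at *
  generalize fderiv ℝ (fderiv ℝ (fderiv ℝ Φ)) x = T at *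
  generalize fderiv ℝ (fderiv ℝ Φ) x = H at *
  generalize fderiv ℝ (fderiv ℝ g) x = G2 at *
  generalize fderiv ℝ g x = G1 at *
  generalize fderiv ℝ Φ x = D1 at *
  generalize g x = γ at *
  set A := (1 + N) / (2 * P) with hA
  have hAN : N = 2 * P * A - 1 := by rw [hA]; field_simp; ring
  have hHe : ∀ v, H e v = A * ⟪e, v⟫ := by
    intro v
    have := hnull v
    rw [hA]
    field_simp
    linarith
  have hee : ⟪e, e⟫ = 1 := by rw [real_inner_self_eq_norm_sq, he]; norm_num
  have hHee : H e e = A := by rw [hHe, hee, mul_one]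
  have hHeu : H e u = A * D1 e := by rw [hHe, real_inner_comm, hug]
  -- Once summed over the basis and reduced by the equation, the second order condition depends on
  -- `s` through `(4 / γ) s² + (8 / γ) s (∂_e g / γ + ∂_e Φ / P)`; this `s` is the minimiser.
  obtain ⟨s, hs⟩ : ∃ s, s = -G1 e / γ - D1 e / P := ⟨_, rfl⟩
  set L := ∑ i, H (b i) (b i) with hL
  set Ke := ∑ i, T e (b i) (b i) with hKe
  set Ku := ∑ i, T u (b i) (b i) with hKu
  set V := ∑ i, D4 e e (b i) (b i) with hV
  set HH := ∑ i, ∑ j, H (b i) (b j) ^ 2 with hHH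
  -- The second order condition for `l = b i`, sorted so that each summand is a constant times an
  -- expression whose sum over the basis is a trace, a square norm or a contraction.
  have key : ∀ i, 0 ≤ (2 * A) * H (b i) (b i) + 4 * (D1 (b i) * T e e (b i))
      + (2 * P) * D4 e e (b i) (b i) - 2 * ∑ j, H (b i) (b j) ^ 2 - 2 * T u (b i) (b i)
      + (-8 * (A * (s + D1 e / P))) * (D1 (b i) * ⟪e, b i⟫)
      + (8 * (s + D1 e / P)) * (⟪b i, e⟫ * H u (b i))
      + (-8 * P * s) * T e (b i) (b i) + (-8) * (⟪b i, e⟫ * T e u (b i))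
      + (4 * P * s ^ 2) * H (b i) (b i) + (8 * s) * (⟪b i, e⟫ * H u (b i))
      + (4 / P * H u u) * ⟪b i, e⟫ ^ 2
      - 2 * (1 + N) * s ^ 2
      - (4 * (1 + N) * s / P) * (⟪b i, e⟫ * D1 (b i))
      - (2 * (1 + N) * (N / P ^ 2)) * ⟪b i, e⟫ ^ 2
      + (2 * (1 + N) * s ^ 2) * ⟪b i, x⟫ ^ 2 := by
    intro i
    have hPne : P ≠ 0 := hΦx.ne'
    -- Since `⟪u, x⟫ = Φ x = P`, the component along `u` cancels `⟪e, b i⟫` in the projection term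
    -- (`i3`), leaving only `-s ⟪b i, x⟫`. The component along `b i` carries the free parameter `s`.
    obtain ⟨ξ, hξ⟩ : ∃ ξ, ξ = -(s • b i) - (⟪b i, e⟫ / P) • u := ⟨_, rfl⟩
    have h := (hcond (b i) ξ).2
    have i1 : ⟪e, ξ⟫ = -(s + D1 e / P) * ⟪b i, e⟫ := by
      rw [hξ, inner_sub_right, inner_neg_right, real_inner_smul_right, real_inner_smul_right,
        real_inner_comm u e, hug, real_inner_comm (b i) e]
      ring
    have i2 : ‖ξ‖ ^ 2 = s ^ 2 + 2 * s / P * (⟪b i, e⟫ * D1 (b i))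
        + N / P ^ 2 * ⟪b i, e⟫ ^ 2 := by
      rw [hξ, ← neg_add', norm_neg, norm_add_sq_real, norm_smul, norm_smul, mul_pow, mul_pow,
        Real.norm_eq_abs, Real.norm_eq_abs, sq_abs, sq_abs, ← hN, b.norm_eq_one,
        real_inner_smul_left, real_inner_smul_right, real_inner_comm u (b i), hug]
      ring
    have i3 : ⟪ξ, x⟫ + ⟪e, b i⟫ = -s * ⟪b i, x⟫ := by
      rw [hξ, inner_sub_left, inner_neg_left, real_inner_smul_left, real_inner_smul_left, hug, hE1,
        real_inner_comm (b i) e, div_mul_cancel₀ _ hPne]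
      ring
    have i4 : T (b i) e ξ = -s * T e (b i) (b i) - ⟪b i, e⟫ / P * T e u (b i) := by
      rw [hξ, hT1, map_sub, map_neg, map_smul, map_smul, smul_eq_mul, smul_eq_mul, hT2 e u]
      ring
    have i5 : H ξ ξ = s ^ 2 * H (b i) (b i) + 2 * s / P * (⟪b i, e⟫ * H u (b i))
        + H u u / P ^ 2 * ⟪b i, e⟫ ^ 2 := by
      rw [hξ]
      simp only [map_sub, map_neg, map_smul, _root_.sub_apply, _root_.neg_apply,
        _root_.smul_apply, smul_eq_mul, hsym (b i) u]
      ring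
    rw [hHe ξ, i1, i2, i3, i4, i5, hHee, hswap, hsym (b i) u, hT1 (b i) e e, hT2 e (b i) e,
      hT2 (b i) (b i) u, hT1 (b i) u] at h
    rw [real_inner_comm (b i) e]
    refine h.trans_eq ?_
    field_simp
    ring
  have hsum := Finset.sum_nonneg fun i (_ : i ∈ Finset.univ) => key i
  have s1 : ∑ i, D1 (b i) * T e e (b i) = T e e u := hsumD1 (T e e)
  have s2 : ∑ i, D1 (b i) * ⟪e, b i⟫ = D1 e := by
    have := hsumD1 (innerSL ℝ e)
    simp only [innerSL_apply_apply] at this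
    rw [this, real_inner_comm, hug]
  have s3 : ∑ i, ⟪b i, e⟫ * H u (b i) = A * D1 e := by
    rw [sum_inner_mul_apply b (H u) e, hsym, hHeu]
  have s4 : ∑ i, ⟪b i, e⟫ * T e u (b i) = T e e u := by
    rw [sum_inner_mul_apply b (T e u) e, hT2]
  have s5 : ∑ i, ⟪b i, e⟫ * D1 (b i) = D1 e := sum_inner_mul_apply b D1 e
  have s6 : ∑ i, ⟪b i, e⟫ ^ 2 = 1 := by rw [sum_inner_sq, he, one_pow]
  have s7 : ∑ i, ⟪b i, x⟫ ^ 2 = 1 := by rw [sum_inner_sq, hx, one_pow]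
  have s8 : ∀ c : ℝ, ∑ _i : ι, c = (n + 1) * c := by
    intro c
    rw [Finset.sum_const, Finset.card_univ, nsmul_eq_mul, hcard]
  simp only [Finset.sum_add_distrib, Finset.sum_sub_distrib, ← Finset.mul_sum, s1, s2, s3, s4, s5,
    s6, s7, s8, ← hL, ← hKe, ← hKu, ← hV, ← hHH] at hsum
  -- The first order condition along `∇Φ` determines `T e e u`; the equation differentiated along
  -- `e`, along `u` and twice along `e` determines the traces `Ke`, `Ku` and `V`.
  have r1 := (hcond u 0).1
  have r3 := (heqd e).1
  have r4 := (heqd u).1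
  have r5 := (heqd e).2
  have hsumHe : ∑ j, H e (b j) ^ 2 = A ^ 2 := by
    simp only [hHe, mul_pow, ← Finset.mul_sum]
    simp only [real_inner_comm _ e, s6, mul_one]
  rw [hNu, hHee, hT1, hT2] at r1
  rw [hHeu, ← hKe] at r3
  rw [hNu, ← hKu] at r4
  rw [hHee, hsumHe, ← hKe, ← hV] at r5
  clear_value A L Ke Ku V HH N P
  clear hcond heqd hsumD1 key hswap hT1 hT2 hsym hnull heq hQ
  have hP0 := hΦx.ne'
  have hγ0 := hgx.ne'
  generalize T e e u = t at *
  generalize H u u = h at *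
  generalize D1 e = p at *
  generalize G1 e = q at *
  generalize G1 u = w at *
  generalize G2 e e = z at *
  have hLv : L = (2 * γ⁻¹ + n + n * N) / (2 * P) := by
    field_simp
    linear_combination γ * heq0 + 2 * mul_inv_cancel₀ hγ0
  have htv : t = (h - N * A) / P := by
    field_simp
    linear_combination r1 / 2
  have hKev : Ke = (-q / γ ^ 2 + n * A * p - p * L) / P := by
    rw [eq_div_iff hP0]
    linear_combination r3 / 2
  have hKuv : Ku = (-w / γ ^ 2 + n * h - N * L) / P := by
    rw [eq_div_iff hP0]
    linear_combination r4 / 2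
  have hVv : V = (-z / γ ^ 2 + 2 * q ^ 2 / γ ^ 3 + n * (A ^ 2 + t) - A * L - 2 * p * Ke) / P := by
    rw [eq_div_iff hP0]
    linear_combination r5 / 2
  -- The hole is the sum in `hsum`: twice the claimed quantity is that sum plus twice the
  -- nonnegative defect of `hlow`.
  suffices hid : 2 * (-z / γ ^ 2 + (w - 2 * q * p) / (γ ^ 2 * P) - 1 / (γ * P ^ 2))
      = _ + 2 * (HH - (2 * A * L - n * A ^ 2)) by
    have := add_nonneg hsum (mul_nonneg zero_le_two (sub_nonneg.mpr hlow))
    rw [← hid] at this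
    linarith
  clear hsum hlow r1 r3 r4 r5 heq0
  rw [hVv, hKuv, hKev, htv, hLv, hs, hAN]
  field_simp
  ring

end NullPoint
end HypChristoffel

namespace HypChristoffel
open Filter Topology

/-! ### Extensions from the sphere to the ambient space -/

section RadialExtension

variable {n : ℕ}

theorem radExt_of_ne {φ : Sph n → ℝ} {y : Amb n} (h : y ≠ 0) :
    radExt φ y = φ ⟨‖y‖⁻¹ • y, by simp [norm_smul, h]⟩ := by
  rw [radExt, dif_pos h]

theorem radExt_coe (φ : Sph n → ℝ) (x : Sph n) : radExt φ x = φ x := by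
  have hx : ‖(x : Amb n)‖ = 1 := norm_eq_of_mem_sphere x
  rw [radExt_of_ne (ne_zero_of_mem_unit_sphere x)]
  congr 1
  ext1
  simp [hx]

theorem radExt_smul (φ : Sph n → ℝ) {c : ℝ} (hc : 0 < c) {y : Amb n} (h : y ≠ 0) :
    radExt φ (c • y) = radExt φ y := by
  rw [radExt_of_ne h, radExt_of_ne (smul_ne_zero hc.ne' h)]
  congr 1
  ext1
  simp only [norm_smul, Real.norm_eq_abs, abs_of_pos hc, mul_inv, smul_smul]
  congr 1
  field_simp

theorem radExt_inv (φ : Sph n → ℝ) {y : Amb n} (h : y ≠ 0) :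
    radExt (fun x => (φ x)⁻¹) y = (radExt φ y)⁻¹ := by
  rw [radExt_of_ne h, radExt_of_ne h]

theorem contDiffAt_radExt {k : ℕ∞} {φ : Sph n → ℝ} (hφ : ContMDiff (𝓡 n) 𝓘(ℝ, ℝ) k φ)
    {y₀ : Amb n} (h : y₀ ≠ 0) : ContDiffAt ℝ k (radExt φ) y₀ := by
  have hpos : 0 < ‖y₀‖ := norm_pos_iff.mpr h
  -- Restricting the codomain to the sphere needs a map that is smooth everywhere. The bump gives a
  -- nowhere vanishing `G` which is the identity near `y₀`; its normalisation agrees there with `y ↦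
  -- y / |y|`.
  let χ : ContDiffBump y₀ := ⟨‖y₀‖ / 4, ‖y₀‖ / 2, by positivity, by linarith⟩
  let G : Amb n → Amb n := fun y => y₀ + χ y • (y - y₀)
  have hG : ContDiff ℝ k G :=
    contDiff_const.add ((χ.contDiff).smul (contDiff_id.sub contDiff_const))
  have hG0 : ∀ y, G y ≠ 0 := by
    intro y hy
    have h1 : ‖χ y • (y - y₀)‖ ≤ ‖y₀‖ / 2 := by
      by_cases hb : y ∈ Metric.ball y₀ (‖y₀‖ / 2)
      · rw [norm_smul, Real.norm_eq_abs, abs_of_nonneg χ.nonneg]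
        rw [mem_ball_iff_norm] at hb
        calc χ y * ‖y - y₀‖ ≤ 1 * ‖y - y₀‖ :=
              mul_le_mul_of_nonneg_right χ.le_one (norm_nonneg _)
          _ ≤ ‖y₀‖ / 2 := by linarith
      · have : χ y = 0 := by
          apply χ.zero_of_le_dist
          simpa using hb
        rw [this, zero_smul, norm_zero]
        positivity
    have h2 : y₀ = -(χ y • (y - y₀)) := eq_neg_of_add_eq_zero_left hy
    have h3 : ‖y₀‖ = ‖χ y • (y - y₀)‖ := by
      conv_lhs => rw [h2]
      rw [norm_neg]
    linarith
  have hGn : ContDiff ℝ k fun y => ‖G y‖⁻¹ • G y :=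
    ((hG.norm ℝ hG0).inv fun y => norm_ne_zero_iff.mpr (hG0 y)).smul hG
  have hmem : ∀ y, ‖G y‖⁻¹ • G y ∈ Metric.sphere (0 : Amb n) 1 := by
    intro y
    simp [norm_smul, hG0 y]
  have := Fact.mk (@finrank_euclideanSpace_fin ℝ _ (n + 1))
  have hcod := hGn.contMDiff.codRestrict_sphere (n := n) hmem
  have hcomp := (hφ.comp hcod).contDiff.contDiffAt (x := y₀)
  refine hcomp.congr_of_eventuallyEq ?_
  filter_upwards [χ.eventuallyEq_one, isOpen_ne.mem_nhds h] with y hy hy0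
  have hGy : G y = y := by
    simp only [G]
    rw [hy]
    simp
  rw [radExt_of_ne hy0]
  simp only [Function.comp_apply]
  congr 1
  ext1
  simp [hGy]

/-- The extension of a function on the sphere that is homogeneous of degree one. -/
noncomputable def homExt (φ : Sph n → ℝ) (y : Amb n) : ℝ := ‖y‖ * radExt φ y

theorem homExt_of_norm_eq_one (φ : Sph n → ℝ) {y : Amb n} (hy : ‖y‖ = 1) :
    homExt φ y = radExt φ y := by rw [homExt, hy, one_mul]

theorem homExt_coe (φ : Sph n → ℝ) (x : Sph n) : homExt φ x = φ x := by
  rw [homExt_of_norm_eq_one φ (norm_eq_of_mem_sphere x), radExt_coe]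

theorem homExt_smul (φ : Sph n → ℝ) {c : ℝ} (hc : 0 < c) {y : Amb n} (h : y ≠ 0) :
    homExt φ (c • y) = c * homExt φ y := by
  rw [homExt, homExt, radExt_smul φ hc h, norm_smul, Real.norm_eq_abs, abs_of_pos hc, mul_assoc]

theorem contDiffAt_homExt {k : ℕ∞} {φ : Sph n → ℝ} (hφ : ContMDiff (𝓡 n) 𝓘(ℝ, ℝ) k φ)
    {y : Amb n} (h : y ≠ 0) : ContDiffAt ℝ k (homExt φ) y :=
  (contDiffAt_norm ℝ h).mul (contDiffAt_radExt hφ h)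

end RadialExtension

/-! ### Euler relations for homogeneous functions -/

section Homogeneity

variable {E F : Type*} [NormedAddCommGroup E] [NormedSpace ℝ E]
  [NormedAddCommGroup F] [NormedSpace ℝ F]

theorem fderiv_smul_of_homogeneous_one {Φ : E → ℝ}
    (h : ∀ c : ℝ, 0 < c → ∀ y : E, y ≠ 0 → Φ (c • y) = c * Φ y) {c : ℝ} (hc : 0 < c) {y : E}
    (hy : y ≠ 0) : fderiv ℝ Φ (c • y) = fderiv ℝ Φ y := by
  have h1 : (fun z => Φ (c • z)) =ᶠ[𝓝 y] fun z => c * Φ z := by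
    filter_upwards [isOpen_ne.mem_nhds hy] with z hz using h c hc z hz
  have h2 := h1.fderiv_eq (𝕜 := ℝ)
  have h3 : fderiv ℝ (fun z => c * Φ z) y = c • fderiv ℝ Φ y := by
    exact congrFun (fderiv_const_smul_field (𝕜 := ℝ) (f := Φ) c) y
  rw [fderiv_comp_smul, h3] at h2
  exact smul_right_injective _ hc.ne' h2

theorem fderiv_smul_of_homogeneous_zero {G : E → F}
    (h : ∀ c : ℝ, 0 < c → ∀ y : E, y ≠ 0 → G (c • y) = G y) {c : ℝ} (hc : 0 < c) {y : E}
    (hy : y ≠ 0) : fderiv ℝ G (c • y) = c⁻¹ • fderiv ℝ G y := by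
  have h1 : (fun z => G (c • z)) =ᶠ[𝓝 y] G := by
    filter_upwards [isOpen_ne.mem_nhds hy] with z hz using h c hc z hz
  have h2 := h1.fderiv_eq (𝕜 := ℝ)
  rw [fderiv_comp_smul] at h2
  rw [← h2, smul_smul, inv_mul_cancel₀ hc.ne', one_smul]

theorem hasDerivAt_along_ray {G : E → F} {y : E} (hG : DifferentiableAt ℝ G y) :
    HasDerivAt (fun s : ℝ => G (s • y)) (fderiv ℝ G y y) 1 := by
  have h : HasDerivAt (fun s : ℝ => s • y) y 1 := by
    simpa using (hasDerivAt_id (1 : ℝ)).smul_const y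
  have hG' : HasFDerivAt G (fderiv ℝ G y) ((1 : ℝ) • y) := by
    simpa using hG.hasFDerivAt
  exact hG'.comp_hasDerivAt (1 : ℝ) h

theorem fderiv_self_of_homogeneous_zero {G : E → F}
    (h : ∀ c : ℝ, 0 < c → ∀ y : E, y ≠ 0 → G (c • y) = G y) {y : E} (hy : y ≠ 0)
    (hG : DifferentiableAt ℝ G y) : fderiv ℝ G y y = 0 := by
  refine (hasDerivAt_along_ray hG).unique ((hasDerivAt_const (1 : ℝ) (G y)).congr_of_eventuallyEq ?_)
  filter_upwards [lt_mem_nhds (zero_lt_one : (0 : ℝ) < 1)] with s hs using h s hs y hy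

theorem fderiv_self_of_homogeneous_one {Φ : E → ℝ}
    (h : ∀ c : ℝ, 0 < c → ∀ y : E, y ≠ 0 → Φ (c • y) = c * Φ y) {y : E} (hy : y ≠ 0)
    (hΦ : DifferentiableAt ℝ Φ y) : fderiv ℝ Φ y y = Φ y := by
  refine (hasDerivAt_along_ray hΦ).unique
    (((hasDerivAt_id (1 : ℝ)).mul_const (Φ y)).congr_of_eventuallyEq ?_ |>.congr_deriv (one_mul _))
  filter_upwards [lt_mem_nhds (zero_lt_one : (0 : ℝ) < 1)] with s hs using h s hs y hy

end Homogeneity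

/-! ### Differentiation along great circles -/

section GreatCircles

variable {E : Type*} [NormedAddCommGroup E] [InnerProductSpace ℝ E]

/-- The great circle through `x` with initial velocity `v`. -/
noncomputable def circ (x v : E) (t : ℝ) : E := Real.cos t • x + Real.sin t • v

/-- The velocity of `circ x v`. -/
noncomputable def circVel (x v : E) (t : ℝ) : E := -Real.sin t • x + Real.cos t • v

theorem hasDerivAt_circ (x v : E) (t : ℝ) : HasDerivAt (circ x v) (circVel x v t) t :=
  ((Real.hasDerivAt_cos t).smul_const x).add ((Real.hasDerivAt_sin t).smul_const v)

theorem hasDerivAt_circVel (x v : E) (t : ℝ) : HasDerivAt (circVel x v) (-circ x v t) t := by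
  refine (((Real.hasDerivAt_sin t).fun_neg.smul_const x).add
    ((Real.hasDerivAt_cos t).smul_const v)).congr_deriv ?_
  simp only [circ, neg_add, neg_smul]

theorem norm_circ {x v : E} (hx : ‖x‖ = 1) (hv : ‖v‖ = 1) (hxv : ⟪v, x⟫ = 0) (t : ℝ) :
    ‖circ x v t‖ = 1 := by
  have : ‖circ x v t‖ ^ 2 = 1 := by
    rw [circ, norm_add_sq_real, norm_smul, norm_smul, mul_pow, mul_pow, hx, hv,
      real_inner_smul_left, real_inner_smul_right, real_inner_comm, hxv, Real.norm_eq_abs,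
      Real.norm_eq_abs, sq_abs, sq_abs]
    linarith [Real.sin_sq_add_cos_sq t]
  exact (sq_eq_sq₀ (norm_nonneg _) zero_le_one).mp (by rw [this, one_pow])

theorem norm_circVel {x v : E} (hx : ‖x‖ = 1) (hv : ‖v‖ = 1) (hxv : ⟪v, x⟫ = 0) (t : ℝ) :
    ‖circVel x v t‖ = 1 := by
  have : ‖circVel x v t‖ ^ 2 = 1 := by
    rw [circVel, norm_add_sq_real, norm_smul, norm_smul, mul_pow, mul_pow, hx, hv,
      real_inner_smul_left, real_inner_smul_right, real_inner_comm, hxv, Real.norm_eq_abs,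
      Real.norm_eq_abs, sq_abs, sq_abs]
    linarith [Real.sin_sq_add_cos_sq t]
  exact (sq_eq_sq₀ (norm_nonneg _) zero_le_one).mp (by rw [this, one_pow])

theorem inner_circVel_circ {x v : E} (hx : ‖x‖ = 1) (hv : ‖v‖ = 1) (hxv : ⟪v, x⟫ = 0) (t : ℝ) :
    ⟪circVel x v t, circ x v t⟫ = 0 := by
  rw [circVel, circ, inner_add_left, inner_add_right, inner_add_right]
  simp only [real_inner_smul_left, real_inner_smul_right, real_inner_self_eq_norm_sq, hx, hv, hxv,
    real_inner_comm v x]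
  ring

theorem circ_zero (x v : E) : circ x v 0 = x := by simp [circ]

theorem circVel_zero (x v : E) : circVel x v 0 = v := by simp [circVel]

theorem hasDerivAt_comp_circ {G : E → ℝ} {x v : E} {t : ℝ}
    (hG : DifferentiableAt ℝ G (circ x v t)) :
    HasDerivAt (fun s => G (circ x v s)) (fderiv ℝ G (circ x v t) (circVel x v t)) t :=
  hG.hasFDerivAt.comp_hasDerivAt t (hasDerivAt_circ x v t)

theorem hasDerivAt_comp_circ₂ {G : E → ℝ} {x v : E} {t : ℝ}
    (hG : DifferentiableAt ℝ (fderiv ℝ G) (circ x v t)) :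
    HasDerivAt (fun s => fderiv ℝ G (circ x v s) (circVel x v s))
      (fderiv ℝ (fderiv ℝ G) (circ x v t) (circVel x v t) (circVel x v t)
        - fderiv ℝ G (circ x v t) (circ x v t)) t := by
  refine ((hG.hasFDerivAt.comp_hasDerivAt t (hasDerivAt_circ x v t)).clm_apply
    (hasDerivAt_circVel x v t)).congr_deriv ?_
  rw [map_neg, sub_eq_add_neg]
  rfl

end GreatCircles
end HypChristoffel

namespace HypChristoffel
open Filter Topology

/-! ### Gradient, Hessian, `U[φ]` and the equation in terms of the homogeneous extension -/

section Operators

variable {n : ℕ} {ι : Type*} [Fintype ι]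

theorem norm_coe_sph (x : Sph n) : ‖(x : Amb n)‖ = 1 := norm_eq_of_mem_sphere x

theorem coe_sph_ne_zero (x : Sph n) : (x : Amb n) ≠ 0 := ne_zero_of_mem_unit_sphere x

theorem mem_tan_iff {x : Sph n} {v : Amb n} : v ∈ Tan x ↔ ⟪v, (x : Amb n)⟫ = 0 := by
  rw [Submodule.mem_orthogonal_singleton_iff_inner_left]

theorem inner_tan (x : Sph n) (v : Tan x) : ⟪(v : Amb n), (x : Amb n)⟫ = 0 := mem_tan_iff.mp v.2

/-- The tangential part of a vector. -/
noncomputable def tanPart (x v : Amb n) : Amb n := v - ⟪v, x⟫ • x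

theorem inner_tanPart {x : Amb n} (hx : ‖x‖ = 1) (v : Amb n) : ⟪tanPart x v, x⟫ = 0 := by
  rw [tanPart, inner_sub_left, real_inner_smul_left, real_inner_self_eq_norm_sq, hx]
  ring

theorem norm_sq_tanPart {x : Amb n} (hx : ‖x‖ = 1) (v : Amb n) :
    ‖tanPart x v‖ ^ 2 = ‖v‖ ^ 2 - ⟪v, x⟫ ^ 2 := by
  rw [tanPart, norm_sub_sq_real, norm_smul, mul_pow, hx, real_inner_smul_right, Real.norm_eq_abs,
    sq_abs]
  ring

theorem gradField_eq (b : OrthonormalBasis ι ℝ (Amb n)) (φ : Sph n → ℝ) :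
    gradField φ = basisGrad b (radExt φ) := by
  funext y
  refine ext_inner_right ℝ fun v => ?_
  rw [inner_basisGrad, gradField, ← toDual_gradient, InnerProductSpace.toDual_apply_apply]

theorem hasFDerivAt_basisGrad (b : OrthonormalBasis ι ℝ (Amb n)) {r : Amb n → ℝ} {x : Amb n}
    (hr : DifferentiableAt ℝ (fderiv ℝ r) x) :
    HasFDerivAt (basisGrad b r)
      (∑ i, ((fderiv ℝ (fderiv ℝ r) x).flip (b i)).smulRight (b i)) x := by
  unfold basisGrad
  refine HasFDerivAt.fun_sum fun i _ => ?_
  refine HasFDerivAt.smul_const ?_ (b i)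
  refine (hr.hasFDerivAt.clm_apply (hasFDerivAt_const (b i) x)).congr_fderiv ?_
  ext v
  simp

theorem fderiv_basisGrad_inner (b : OrthonormalBasis ι ℝ (Amb n)) {r : Amb n → ℝ} {x : Amb n}
    (hr : DifferentiableAt ℝ (fderiv ℝ r) x) (v w : Amb n) :
    ⟪fderiv ℝ (basisGrad b r) x v, w⟫ = fderiv ℝ (fderiv ℝ r) x v w := by
  rw [(hasFDerivAt_basisGrad b hr).fderiv, ← sum_inner_mul_apply b (fderiv ℝ (fderiv ℝ r) x v) w]
  simp [sum_inner, real_inner_smul_left, mul_comm]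

theorem inner_hess {φ : Sph n → ℝ} {x : Sph n}
    (hr : DifferentiableAt ℝ (fderiv ℝ (radExt φ)) x) (v : Tan x) :
    ⟪hess φ x v, v⟫ = fderiv ℝ (fderiv ℝ (radExt φ)) x v v := by
  rw [← fderiv_basisGrad_inner (EuclideanSpace.basisFun (Fin (n + 1)) ℝ) hr,
    ← gradField_eq]
  simp only [hess]
  exact Submodule.inner_orthogonalProjectionOnto_eq_of_mem_right v _

theorem fderiv_radExt_self {φ : Sph n → ℝ} {y : Amb n} (hy : y ≠ 0)
    (hr : DifferentiableAt ℝ (radExt φ) y) : fderiv ℝ (radExt φ) y y = 0 :=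
  fderiv_self_of_homogeneous_zero (fun _ hc _ hz => radExt_smul φ hc hz) hy hr

theorem norm_grad (b : OrthonormalBasis ι ℝ (Amb n)) {φ : Sph n → ℝ} {x : Sph n}
    (hr : DifferentiableAt ℝ (radExt φ) x) : ‖grad φ x‖ = ‖basisGrad b (radExt φ) x‖ := by
  have hmem : basisGrad b (radExt φ) x ∈ Tan x := by
    rw [mem_tan_iff, inner_basisGrad, fderiv_radExt_self (coe_sph_ne_zero x) hr]
  rw [grad, gradField_eq b, Submodule.coe_norm]
  congr 1
  exact Submodule.orthogonalProjectionOnto_mem_subspace_eq_self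
    (⟨basisGrad b (radExt φ) x, hmem⟩ : Tan x) |> congrArg Subtype.val

theorem homExt_circ_eq {φ : Sph n → ℝ} {x v : Amb n} (hx : ‖x‖ = 1) (hv : ‖v‖ = 1)
    (hvx : ⟪v, x⟫ = 0) :
    (fun t => homExt φ (circ x v t)) = fun t => radExt φ (circ x v t) := by
  funext t
  exact homExt_of_norm_eq_one φ (norm_circ hx hv hvx t)

theorem circ_ne_zero {x v : Amb n} (hx : ‖x‖ = 1) (hv : ‖v‖ = 1) (hvx : ⟪v, x⟫ = 0) (t : ℝ) :
    circ x v t ≠ 0 := by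
  rw [← norm_ne_zero_iff, norm_circ hx hv hvx t]
  exact one_ne_zero

variable {φ : Sph n → ℝ}

theorem contDiffAt_four_radExt (hφ : ContMDiff (𝓡 n) 𝓘(ℝ, ℝ) 4 φ) {y : Amb n} (h : y ≠ 0) :
    ContDiffAt ℝ 4 (radExt φ) y :=
  contDiffAt_radExt (k := 4) hφ h

theorem contDiffAt_four_homExt (hφ : ContMDiff (𝓡 n) 𝓘(ℝ, ℝ) 4 φ) {y : Amb n} (h : y ≠ 0) :
    ContDiffAt ℝ 4 (homExt φ) y :=
  contDiffAt_homExt (k := 4) hφ h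

theorem differentiableAt_fderiv {G : Amb n → ℝ} {y : Amb n} (h : ContDiffAt ℝ 4 G y) :
    DifferentiableAt ℝ (fderiv ℝ G) y :=
  ((eventually_differentiableAt_of_contDiffAt_four h).self_of_nhds.2.1).differentiableAt
    (by norm_num)

theorem fderiv_homExt_self (hφ : ContMDiff (𝓡 n) 𝓘(ℝ, ℝ) 4 φ) {y : Amb n} (hy : y ≠ 0) :
    fderiv ℝ (homExt φ) y y = homExt φ y :=
  fderiv_self_of_homogeneous_one (fun _ hc _ hz => homExt_smul φ hc hz) hy
    ((contDiffAt_four_homExt hφ hy).differentiableAt (by norm_num))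

theorem fderiv_homExt_smul (φ : Sph n → ℝ) {c : ℝ} (hc : 0 < c) {y : Amb n} (hy : y ≠ 0) :
    fderiv ℝ (homExt φ) (c • y) = fderiv ℝ (homExt φ) y :=
  fderiv_smul_of_homogeneous_one (fun _ hc _ hz => homExt_smul φ hc hz) hc hy

theorem snd_fderiv_homExt_smul (φ : Sph n → ℝ) {c : ℝ} (hc : 0 < c) {y : Amb n} (hy : y ≠ 0) :
    fderiv ℝ (fderiv ℝ (homExt φ)) (c • y) = c⁻¹ • fderiv ℝ (fderiv ℝ (homExt φ)) y :=
  fderiv_smul_of_homogeneous_zero (fun _ hc _ hz => fderiv_homExt_smul φ hc hz) hc hy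

theorem snd_fderiv_homExt_self_left (hφ : ContMDiff (𝓡 n) 𝓘(ℝ, ℝ) 4 φ) {y : Amb n}
    (hy : y ≠ 0) : fderiv ℝ (fderiv ℝ (homExt φ)) y y = 0 :=
  fderiv_self_of_homogeneous_zero (fun _ hc _ hz => fderiv_homExt_smul φ hc hz) hy
    (differentiableAt_fderiv (contDiffAt_four_homExt hφ hy))

theorem snd_fderiv_homExt_self_right (hφ : ContMDiff (𝓡 n) 𝓘(ℝ, ℝ) 4 φ) {y : Amb n}
    (hy : y ≠ 0) (v : Amb n) : fderiv ℝ (fderiv ℝ (homExt φ)) y v y = 0 := by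
  rw [snd_fderiv_symm ((contDiffAt_four_homExt hφ hy).of_le (by norm_num)),
    snd_fderiv_homExt_self_left hφ hy, _root_.zero_apply]

/-- The second derivative of `homExt φ` only sees tangential parts. -/
theorem snd_fderiv_homExt_tanPart (hφ : ContMDiff (𝓡 n) 𝓘(ℝ, ℝ) 4 φ) {x : Amb n}
    (hx : x ≠ 0) (v : Amb n) :
    fderiv ℝ (fderiv ℝ (homExt φ)) x (tanPart x v) (tanPart x v)
      = fderiv ℝ (fderiv ℝ (homExt φ)) x v v := by
  simp [tanPart, snd_fderiv_homExt_self_left hφ hx, snd_fderiv_homExt_self_right hφ hx]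

theorem exists_unit_of_tangent {x w : Amb n} (hw : ⟪w, x⟫ = 0) (hw0 : w ≠ 0) :
    ∃ v : Amb n, ‖v‖ = 1 ∧ ⟪v, x⟫ = 0 ∧ w = ‖w‖ • v := by
  have h := norm_ne_zero_iff.mpr hw0
  refine ⟨‖w‖⁻¹ • w, ?_, ?_, ?_⟩
  · rw [norm_smul, norm_inv, norm_norm, inv_mul_cancel₀ h]
  · rw [real_inner_smul_left, hw, mul_zero]
  · rw [smul_smul, mul_inv_cancel₀ h, one_smul]

/-- The two extensions agree along every great circle, so their derivatives in the direction of its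
velocity agree. -/
theorem fderiv_homExt_tangent (hφ : ContMDiff (𝓡 n) 𝓘(ℝ, ℝ) 4 φ) {x w : Amb n} (hx : ‖x‖ = 1)
    (hw : ⟪w, x⟫ = 0) : fderiv ℝ (homExt φ) x w = fderiv ℝ (radExt φ) x w := by
  rcases eq_or_ne w 0 with rfl | hw0
  · simp
  obtain ⟨v, hv, hvx, hwv⟩ := exists_unit_of_tangent hw hw0
  have h0 := circ_ne_zero hx hv hvx 0
  have e1 := hasDerivAt_comp_circ
    ((contDiffAt_four_homExt hφ h0).differentiableAt (by norm_num))
  have e2 := hasDerivAt_comp_circ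
    ((contDiffAt_four_radExt hφ h0).differentiableAt (by norm_num))
  rw [homExt_circ_eq hx hv hvx] at e1
  have := e1.unique e2
  rw [circ_zero, circVel_zero] at this
  rw [hwv, map_smul, map_smul, this]

theorem fderiv_homExt_eq (hφ : ContMDiff (𝓡 n) 𝓘(ℝ, ℝ) 4 φ) {x : Amb n} (hx : ‖x‖ = 1)
    (v : Amb n) :
    fderiv ℝ (homExt φ) x v = fderiv ℝ (radExt φ) x v + homExt φ x * ⟪v, x⟫ := by
  have hx0 : x ≠ 0 := by rw [← norm_ne_zero_iff, hx]; exact one_ne_zero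
  have h := fderiv_homExt_tangent hφ hx (inner_tanPart hx v)
  rw [tanPart, map_sub, map_sub, map_smul, map_smul, fderiv_homExt_self hφ hx0,
    fderiv_radExt_self hx0 ((contDiffAt_four_radExt hφ hx0).differentiableAt (by norm_num))] at h
  simp only [smul_eq_mul] at h
  linarith

/-- A great circle has acceleration `-x`, so the second derivative along it is `D²G(v, v) - DG(x)`.
The last term is `Φ` in degree one and `0` in degree zero, which accounts for the difference. -/
theorem snd_fderiv_homExt_tangent (hφ : ContMDiff (𝓡 n) 𝓘(ℝ, ℝ) 4 φ) {x w : Amb n}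
    (hx : ‖x‖ = 1) (hw : ⟪w, x⟫ = 0) :
    fderiv ℝ (fderiv ℝ (homExt φ)) x w w
      = fderiv ℝ (fderiv ℝ (radExt φ)) x w w + homExt φ x * ‖w‖ ^ 2 := by
  rcases eq_or_ne w 0 with rfl | hw0
  · simp
  obtain ⟨v, hv, hvx, hwv⟩ := exists_unit_of_tangent hw hw0
  have h0 := circ_ne_zero hx hv hvx
  have e1 := hasDerivAt_comp_circ₂ (t := 0)
    (differentiableAt_fderiv (contDiffAt_four_homExt hφ (h0 0)))
  have e2 := hasDerivAt_comp_circ₂ (t := 0)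
    (differentiableAt_fderiv (contDiffAt_four_radExt hφ (h0 0)))
  have heq : (fun s => fderiv ℝ (homExt φ) (circ x v s) (circVel x v s))
      = fun s => fderiv ℝ (radExt φ) (circ x v s) (circVel x v s) := by
    funext s
    exact fderiv_homExt_tangent hφ (norm_circ hx hv hvx s) (inner_circVel_circ hx hv hvx s)
  rw [heq] at e1
  have := e1.unique e2
  have hx0 : x ≠ 0 := by simpa [circ_zero] using h0 0
  rw [circ_zero, circVel_zero, fderiv_homExt_self hφ hx0,
    fderiv_radExt_self hx0 ((contDiffAt_four_radExt hφ hx0).differentiableAt (by norm_num))] at this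
  rw [hwv]
  simp only [map_smul, _root_.smul_apply, smul_eq_mul, norm_smul, norm_norm, hv]
  linear_combination ‖w‖ ^ 2 * this

theorem basisGrad_homExt (b : OrthonormalBasis ι ℝ (Amb n)) (hφ : ContMDiff (𝓡 n) 𝓘(ℝ, ℝ) 4 φ)
    (x : Sph n) :
    basisGrad b (homExt φ) x = basisGrad b (radExt φ) x + φ x • (x : Amb n) := by
  refine ext_inner_right ℝ fun v => ?_
  rw [inner_basisGrad, inner_add_left, inner_basisGrad, fderiv_homExt_eq hφ (norm_coe_sph x),
    homExt_coe, real_inner_smul_left, real_inner_comm]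

theorem gradSq_homExt (b : OrthonormalBasis ι ℝ (Amb n)) (hφ : ContMDiff (𝓡 n) 𝓘(ℝ, ℝ) 4 φ)
    (x : Sph n) : gradSq b (homExt φ) x = ‖grad φ x‖ ^ 2 + φ x ^ 2 := by
  have hx := norm_coe_sph x
  have hx0 := coe_sph_ne_zero x
  have hd : DifferentiableAt ℝ (radExt φ) x :=
    (contDiffAt_four_radExt hφ hx0).differentiableAt (by norm_num)
  rw [gradSq_eq, basisGrad_homExt b hφ, norm_add_sq_real, norm_grad b hd, real_inner_smul_right, inner_basisGrad,
    fderiv_radExt_self hx0 hd, norm_smul, hx, mul_one, Real.norm_eq_abs, sq_abs]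
  ring

/-- The two terms `φ |v|²` and `-φ² |v|²`, coming from the Hessian and from the gradient of the
extension, combine to the zeroth order term of `U[φ]`. -/
theorem two_mul_inner_U (b : OrthonormalBasis ι ℝ (Amb n)) (hφ : ContMDiff (𝓡 n) 𝓘(ℝ, ℝ) 4 φ)
    (x : Sph n) (hpos : 0 < φ x) (v : Tan x) :
    2 * φ x * ⟪U φ x v, v⟫ = 2 * φ x * fderiv ℝ (fderiv ℝ (homExt φ)) x v v
      - (1 + gradSq b (homExt φ) x) * ‖(v : Amb n)‖ ^ 2 := by
  have hx0 := coe_sph_ne_zero x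
  have hh := inner_hess (differentiableAt_fderiv (contDiffAt_four_radExt hφ hx0)) v
  rw [snd_fderiv_homExt_tangent hφ (norm_coe_sph x) (inner_tan x v), ← hh, gradSq_homExt b hφ,
    homExt_coe, ← Submodule.coe_norm v]
  simp only [U, LinearMap.add_apply, LinearMap.sub_apply, LinearMap.smul_apply, LinearMap.id_apply,
    inner_add_left, inner_sub_left, real_inner_smul_left, real_inner_self_eq_norm_sq]
  have := hpos.ne'
  field_simp
  ring

/-- Both sides are homogeneous of degree zero in `y` and see only the part of `v` orthogonal to `y`,
so the claim reduces to `U[φ] ≥ 0` on the sphere. Having it in an open set allows variations along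
straight lines. -/
theorem quadratic_form_nonneg (b : OrthonormalBasis ι ℝ (Amb n))
    (hφ : ContMDiff (𝓡 n) 𝓘(ℝ, ℝ) 4 φ) (hpos : ∀ x, 0 < φ x) (hU : ∀ x, (U φ x).IsPositive)
    {y : Amb n} (hy : y ≠ 0) (v : Amb n) :
    (1 + gradSq b (homExt φ) y) * (‖v‖ ^ 2 - ⟪v, y⟫ ^ 2 / ‖y‖ ^ 2)
      ≤ 2 * homExt φ y * fderiv ℝ (fderiv ℝ (homExt φ)) y v v := by
  have hyn : 0 < ‖y‖ := norm_pos_iff.mpr hy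
  have hx : ‖‖y‖⁻¹ • y‖ = 1 := by rw [norm_smul, norm_inv, norm_norm, inv_mul_cancel₀ hyn.ne']
  obtain ⟨x, hxy⟩ : ∃ x : Sph n, (x : Amb n) = ‖y‖⁻¹ • y := ⟨⟨_, by simpa using hx⟩, rfl⟩
  have hx0 := coe_sph_ne_zero x
  have hyx : y = ‖y‖ • (x : Amb n) := by rw [hxy, smul_smul, mul_inv_cancel₀ hyn.ne', one_smul]
  have hmain := two_mul_inner_U b hφ x (hpos x)
    ⟨tanPart x v, mem_tan_iff.mpr (inner_tanPart (norm_coe_sph x) v)⟩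
  have hnn := (hU x).inner_nonneg_left
    ⟨tanPart x v, mem_tan_iff.mpr (inner_tanPart (norm_coe_sph x) v)⟩
  have h2 := mul_nonneg (mul_nonneg zero_le_two (hpos x).le) hnn
  rw [hmain] at h2
  simp only [snd_fderiv_homExt_tanPart hφ hx0, norm_sq_tanPart (norm_coe_sph x)] at h2
  have hvy : ⟪v, y⟫ = ‖y‖ * ⟪v, (x : Amb n)⟫ := by
    conv_lhs => rw [hyx]
    rw [real_inner_smul_right]
  have hg : gradSq b (homExt φ) y = gradSq b (homExt φ) x := by
    unfold gradSq
    conv_lhs => rw [hyx, fderiv_homExt_smul φ hyn hx0]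
  have hh : homExt φ y * fderiv ℝ (fderiv ℝ (homExt φ)) y v v
      = φ x * fderiv ℝ (fderiv ℝ (homExt φ)) x v v := by
    conv_lhs => rw [hyx, snd_fderiv_homExt_smul φ hyn hx0, homExt_smul φ hyn hx0, homExt_coe]
    simp only [_root_.smul_apply, smul_eq_mul]
    field_simp
  rw [hvy, hg, mul_assoc 2, hh]
  have : (‖y‖ * ⟪v, (x : Amb n)⟫) ^ 2 / ‖y‖ ^ 2 = ⟪v, (x : Amb n)⟫ ^ 2 := by field_simp
  rw [this]
  linarith

theorem finrank_tan (x : Sph n) : Module.finrank ℝ (Tan x) = n := by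
  have := Fact.mk (@finrank_euclideanSpace_fin ℝ _ (n + 1))
  exact Submodule.finrank_orthogonal_span_singleton (coe_sph_ne_zero x)

/-- The radial direction lies in the kernel of `D²Φ`, so the full trace equals the tangential one;
cyclicity of the trace moves the projection across. -/
theorem flatLap_homExt (b : OrthonormalBasis ι ℝ (Amb n)) (hφ : ContMDiff (𝓡 n) 𝓘(ℝ, ℝ) 4 φ)
    (x : Sph n) : flatLap b (homExt φ) x = lap φ x + n * φ x := by
  have hx0 := coe_sph_ne_zero x
  have hdr := differentiableAt_fderiv (contDiffAt_four_radExt hφ hx0)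
  have hdh := differentiableAt_fderiv (contDiffAt_four_homExt hφ hx0)
  let M : Amb n →L[ℝ] Amb n := fderiv ℝ (basisGrad b (homExt φ)) x
  let c := stdOrthonormalBasis ℝ (Tan x)
  have hcard : Fintype.card (Fin (Module.finrank ℝ (Tan x))) = n := by
    rw [Fintype.card_fin, finrank_tan]
  have h1 : lap φ x + n * φ x
      = ∑ k, fderiv ℝ (fderiv ℝ (homExt φ)) x (c k : Amb n) (c k : Amb n) := by
    have : ∀ k, fderiv ℝ (fderiv ℝ (homExt φ)) x (c k : Amb n) (c k : Amb n)
        = ⟪c k, hess φ x (c k)⟫ + φ x := by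
      intro k
      rw [snd_fderiv_homExt_tangent hφ (norm_coe_sph x) (inner_tan x (c k)), ← inner_hess hdr,
        homExt_coe, ← Submodule.coe_norm, c.norm_eq_one, real_inner_comm]
      ring
    rw [Finset.sum_congr rfl fun k _ => this k, Finset.sum_add_distrib, lap,
      LinearMap.trace_eq_sum_inner _ c, Finset.sum_const, Finset.card_univ, hcard, nsmul_eq_mul]
  have h2 : ∑ k, fderiv ℝ (fderiv ℝ (homExt φ)) x (c k : Amb n) (c k : Amb n)
      = LinearMap.trace ℝ (Tan x) (((Tan x).orthogonalProjectionOnto : Amb n →ₗ[ℝ] Tan x) ∘ₗ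
        ((M : Amb n →ₗ[ℝ] Amb n) ∘ₗ (Tan x).subtype)) := by
    rw [LinearMap.trace_eq_sum_inner _ c]
    refine Finset.sum_congr rfl fun k _ => ?_
    rw [← fderiv_basisGrad_inner b hdh, real_inner_comm]
    exact (Submodule.inner_orthogonalProjectionOnto_eq_of_mem_left (c k) _).symm
  have h3 : ((M : Amb n →ₗ[ℝ] Amb n) ∘ₗ (Tan x).subtype) ∘ₗ
      ((Tan x).orthogonalProjectionOnto : Amb n →ₗ[ℝ] Tan x) = M := by
    ext1 v
    have hP : v - ((Tan x).orthogonalProjectionOnto v : Amb n) ∈ ℝ ∙ (x : Amb n) :=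
      (Submodule.orthogonal_orthogonal (ℝ ∙ (x : Amb n))).le
        (Submodule.sub_starProjection_mem_orthogonal (K := Tan x) v)
    obtain ⟨a, ha⟩ := Submodule.mem_span_singleton.mp hP
    have hMx : M x = 0 := by
      refine ext_inner_right ℝ fun w => ?_
      rw [fderiv_basisGrad_inner b hdh, snd_fderiv_homExt_self_left hφ hx0, inner_zero_left,
        _root_.zero_apply]
    have : M (v - ((Tan x).orthogonalProjectionOnto v : Amb n)) = 0 := by
      rw [← ha, map_smul, hMx, smul_zero]
    rw [map_sub, sub_eq_zero] at this
    exact this.symm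
  rw [h1, h2, LinearMap.trace_comp_comm', h3, LinearMap.trace_eq_sum_inner _ b, flatLap]
  refine Finset.sum_congr rfl fun i _ => ?_
  rw [real_inner_comm, ← fderiv_basisGrad_inner b hdh]
  rfl

/-- This is the equation multiplied by `2 φ`, carried from the sphere to all rays by homogeneity of
degree zero. -/
theorem equation_homExt (b : OrthonormalBasis ι ℝ (Amb n)) {f : Sph n → ℝ} (hs : IsSolution f φ)
    {y : Amb n} (hy : y ≠ 0) :
    2 * homExt φ y * flatLap b (homExt φ) y - n * gradSq b (homExt φ) y
      = 2 * (radExt (fun x => (f x)⁻¹) y)⁻¹ + n := by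
  have hφ := hs.contMDiff
  have hyn : 0 < ‖y‖ := norm_pos_iff.mpr hy
  have hx : ‖‖y‖⁻¹ • y‖ = 1 := by rw [norm_smul, norm_inv, norm_norm, inv_mul_cancel₀ hyn.ne']
  obtain ⟨x, hxy⟩ : ∃ x : Sph n, (x : Amb n) = ‖y‖⁻¹ • y := ⟨⟨_, by simpa using hx⟩, rfl⟩
  have hx0 := coe_sph_ne_zero x
  have hyx : y = ‖y‖ • (x : Amb n) := by rw [hxy, smul_smul, mul_inv_cancel₀ hyn.ne', one_smul]
  have hg : gradSq b (homExt φ) y = gradSq b (homExt φ) x := by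
    unfold gradSq
    conv_lhs => rw [hyx, fderiv_homExt_smul φ hyn hx0]
  have hl : homExt φ y * flatLap b (homExt φ) y = φ x * flatLap b (homExt φ) x := by
    unfold flatLap
    conv_lhs => rw [hyx, snd_fderiv_homExt_smul φ hyn hx0, homExt_smul φ hyn hx0, homExt_coe]
    simp only [_root_.smul_apply, smul_eq_mul, ← Finset.mul_sum]
    field_simp
  have hf : radExt (fun x => (f x)⁻¹) y = (f x)⁻¹ := by
    conv_lhs => rw [hyx]
    rw [radExt_smul _ hyn hx0, radExt_coe]
  have he := hs.eqn x
  have hp := (hs.pos x).ne'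
  rw [mul_assoc, hl, hg, hf, inv_inv, flatLap_homExt b hφ, gradSq_homExt b hφ]
  field_simp at he
  linarith

end Operators
end HypChristoffel

namespace HypChristoffel
open Filter Topology

/-! ### `C⁰` and `C¹` estimates for even `h`-convex solutions -/

section Estimates

variable {n : ℕ} {φ f : Sph n → ℝ}

theorem sq_add_sq_le_norm_sq {E : Type*} [NormedAddCommGroup E] [InnerProductSpace ℝ E]
    {v w : E} (hv : ‖v‖ = 1) (hw : ‖w‖ = 1) (hvw : ⟪v, w⟫ = 0) (u : E) :
    ⟪u, v⟫ ^ 2 + ⟪u, w⟫ ^ 2 ≤ ‖u‖ ^ 2 := by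
  have h := sq_nonneg ‖u - (⟪u, v⟫ • v + ⟪u, w⟫ • w)‖
  rw [norm_sub_sq_real, norm_add_sq_real, inner_add_right] at h
  simp only [real_inner_smul_left, real_inner_smul_right, norm_smul, hv, hw, hvw, mul_pow,
    Real.norm_eq_abs, sq_abs] at h
  linarith

/-- The ambient gradient has component `p'` along the velocity and, by Euler's relation, `p` along
the position, so `|∇Φ|² ≥ p'² + p²` turns semi-definiteness into the scalar inequality needed for
comparison. -/
theorem hconvex_along_circ (hφ : ContMDiff (𝓡 n) 𝓘(ℝ, ℝ) 4 φ) (hpos : ∀ x, 0 < φ x)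
    (hU : ∀ x, (U φ x).IsPositive) {x v : Amb n} (hx : ‖x‖ = 1) (hv : ‖v‖ = 1)
    (hvx : ⟪v, x⟫ = 0) (t : ℝ) :
    HasDerivAt (fun s => homExt φ (circ x v s))
      (fderiv ℝ (homExt φ) (circ x v t) (circVel x v t)) t ∧
    HasDerivAt (fun s => fderiv ℝ (homExt φ) (circ x v s) (circVel x v s))
      (fderiv ℝ (fderiv ℝ (homExt φ)) (circ x v t) (circVel x v t) (circVel x v t)
        - homExt φ (circ x v t)) t ∧
    0 < homExt φ (circ x v t) ∧
    1 + fderiv ℝ (homExt φ) (circ x v t) (circVel x v t) ^ 2 + homExt φ (circ x v t) ^ 2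
      ≤ 2 * homExt φ (circ x v t)
        * (fderiv ℝ (fderiv ℝ (homExt φ)) (circ x v t) (circVel x v t) (circVel x v t)
        - homExt φ (circ x v t) + homExt φ (circ x v t)) := by
  have h0 := circ_ne_zero hx hv hvx t
  have hc := norm_circ hx hv hvx t
  have hd := contDiffAt_four_homExt hφ h0
  have he := fderiv_homExt_self hφ h0
  refine ⟨hasDerivAt_comp_circ (hd.differentiableAt (by norm_num)), ?_, ?_, ?_⟩
  · have := hasDerivAt_comp_circ₂ (differentiableAt_fderiv hd)
    rwa [he] at this
  · rw [homExt_of_norm_eq_one φ hc, radExt_of_ne h0]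
    exact hpos _
  · let b := EuclideanSpace.basisFun (Fin (n + 1)) ℝ
    have h1 := quadratic_form_nonneg b hφ hpos hU h0 (circVel x v t)
    have h2 := sq_add_sq_le_norm_sq (norm_circVel hx hv hvx t) hc
      (inner_circVel_circ hx hv hvx t) (basisGrad b (homExt φ) (circ x v t))
    rw [inner_basisGrad, inner_basisGrad, he, ← gradSq_eq] at h2
    rw [norm_circVel hx hv hvx t, inner_circVel_circ hx hv hvx t, hc] at h1
    rw [sub_add_cancel]
    linarith

theorem exists_unit_tangent (hn : 1 ≤ n) (x : Sph n) :
    ∃ v : Amb n, ‖v‖ = 1 ∧ ⟪v, (x : Amb n)⟫ = 0 := by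
  have : Nontrivial (Tan x) := by
    apply Module.nontrivial_of_finrank_pos (R := ℝ)
    rw [finrank_tan]
    omega
  obtain ⟨w, hw⟩ := exists_ne (0 : Tan x)
  obtain ⟨v, hv, hvx, -⟩ := exists_unit_of_tangent (inner_tan x w) (by simpa using hw)
  exact ⟨v, hv, hvx⟩

/-- A unit tangent vector in the direction of the gradient. -/
theorem exists_unit_tangent_grad (hn : 1 ≤ n) (hφ : ContMDiff (𝓡 n) 𝓘(ℝ, ℝ) 4 φ) (x : Sph n) :
    ∃ v : Amb n, ‖v‖ = 1 ∧ ⟪v, (x : Amb n)⟫ = 0 ∧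
      fderiv ℝ (homExt φ) x v = ‖grad φ x‖ := by
  let b := EuclideanSpace.basisFun (Fin (n + 1)) ℝ
  have hx0 := coe_sph_ne_zero x
  have hd : DifferentiableAt ℝ (radExt φ) x :=
    (contDiffAt_four_radExt hφ hx0).differentiableAt (by norm_num)
  rw [norm_grad b hd]
  rcases eq_or_ne (basisGrad b (radExt φ) x) 0 with h | h
  · obtain ⟨v, hv, hvx⟩ := exists_unit_tangent hn x
    refine ⟨v, hv, hvx, ?_⟩
    rw [fderiv_homExt_tangent hφ (norm_coe_sph x) hvx, ← inner_basisGrad b, h, inner_zero_left,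
      norm_zero]
  · have hux : ⟪basisGrad b (radExt φ) x, (x : Amb n)⟫ = 0 := by
      rw [inner_basisGrad, fderiv_radExt_self hx0 hd]
    obtain ⟨v, hv, hvx, hw⟩ := exists_unit_of_tangent hux h
    refine ⟨v, hv, hvx, ?_⟩
    rw [fderiv_homExt_tangent hφ (norm_coe_sph x) hvx, ← inner_basisGrad b]
    conv_lhs => rw [hw]
    rw [real_inner_smul_left, real_inner_self_eq_norm_sq, hv]
    ring

theorem homExt_neg (hφ_even : IsEven φ) (x : Sph n) : homExt φ (-(x : Amb n)) = φ x := by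
  rw [← hφ_even x]
  exact homExt_coe φ (-x)

/-- Follow the great circle in the gradient direction to `-x`. With `m = φ x` and `c = |Dφ|`, the
comparison function starts at `A + b = m` with slope `c` and ends at `A - b = (1 + c²) / m`, while
evenness returns `φ` to `m`. -/
theorem one_add_norm_grad_sq_le (hn : 1 ≤ n) (hφ : ContMDiff (𝓡 n) 𝓘(ℝ, ℝ) 4 φ)
    (hpos : ∀ x, 0 < φ x) (hU : ∀ x, (U φ x).IsPositive) (hφ_even : IsEven φ) (x : Sph n) :
    1 + ‖grad φ x‖ ^ 2 ≤ φ x ^ 2 := by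
  obtain ⟨v, hv, hvx, hgv⟩ := exists_unit_tangent_grad hn hφ x
  have hc := hconvex_along_circ hφ hpos hU (norm_coe_sph x) hv hvx
  obtain ⟨m, hm⟩ : ∃ m, m = φ x := ⟨_, rfl⟩
  obtain ⟨c, hcdef⟩ : ∃ c, c = ‖grad φ x‖ := ⟨_, rfl⟩
  have hm0 : 0 < m := hm ▸ hpos x
  have hc0 : 0 ≤ c := hcdef ▸ norm_nonneg _
  have hAb : (1 + c ^ 2 + m ^ 2) / (2 * m) - (m - (1 + c ^ 2 + m ^ 2) / (2 * m))
      = (1 + c ^ 2) / m := by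
    field_simp
    ring
  have hAbpos : 0 < (1 + c ^ 2) / m := by positivity
  -- The weight is `χ = c (1 + cos t) + (A - b) sin t`, nonnegative on `[0, π]` and zero at `π`.
  have key := comparison_of_hconvex (fun t => (hc t).1) (fun t => (hc t).2.1)
    (fun t => (hc t).2.2.1) (fun t => (hc t).2.2.2)
    (A := (1 + c ^ 2 + m ^ 2) / (2 * m)) (b := m - (1 + c ^ 2 + m ^ 2) / (2 * m)) (c := c)
    (a₀ := c) (a₁ := c) (a₂ := (1 + c ^ 2) / m) (T := Real.pi)
    (by positivity) (by field_simp; ring) (by rw [circ_zero, homExt_coe, hm]; ring)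
    (by rw [circ_zero, circVel_zero, hgv, hcdef]) Real.pi_pos.le (by rw [← hAb]; ring)
    (by
      intro t ht
      have h1 := Real.sin_nonneg_of_nonneg_of_le_pi ht.1 ht.2
      have h2 := mul_nonneg hc0 (by linarith [Real.neg_one_le_cos t] : 0 ≤ 1 + Real.cos t)
      have h3 := mul_nonneg hAbpos.le h1
      linarith)
    (by simp) (by simpa using hAbpos)
  have hpi : circ (x : Amb n) v Real.pi = -(x : Amb n) := by simp [circ]
  rw [hpi, homExt_neg hφ_even, Real.cos_pi, Real.sin_pi, ← hm] at key
  have h4 : (1 + c ^ 2) / m ≤ m := by linarith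
  rw [div_le_iff₀ hm0] at h4
  rw [← hm, ← hcdef]
  linarith

theorem homExt_circ_coe {x : Sph n} {v : Amb n} (hv : ‖v‖ = 1) (hvx : ⟪v, (x : Amb n)⟫ = 0)
    (t : ℝ) : ∃ z : Sph n, homExt φ (circ x v t) = φ z := by
  have h : circ (x : Amb n) v t ∈ Metric.sphere (0 : Amb n) 1 :=
    mem_sphere_zero_iff_norm.mpr (norm_circ (norm_coe_sph x) hv hvx t)
  exact ⟨⟨circ (x : Amb n) v t, h⟩, homExt_coe φ ⟨circ (x : Amb n) v t, h⟩⟩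

/-- At a maximum `p' = 0` and `p'' ≤ 0`, so the scalar inequality leaves `1 + p² ≤ 2 p²`. -/
theorem one_le_of_isMax (hφ : ContMDiff (𝓡 n) 𝓘(ℝ, ℝ) 4 φ)
    (hpos : ∀ x, 0 < φ x) (hU : ∀ x, (U φ x).IsPositive) {x : Sph n} (hmax : ∀ z, φ z ≤ φ x)
    {v : Amb n} (hv : ‖v‖ = 1) (hvx : ⟪v, (x : Amb n)⟫ = 0) :
    fderiv ℝ (homExt φ) x v = 0 ∧ 1 ≤ φ x := by
  have hc := hconvex_along_circ hφ hpos hU (norm_coe_sph x) hv hvx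
  have h := second_deriv_nonneg_of_isMin (fun t => (hc t).1.fun_neg) (hc 0).2.1.fun_neg
    (fun t => by
      obtain ⟨z, hz⟩ := homExt_circ_coe (φ := φ) hv hvx t
      rw [circ_zero, homExt_coe, hz]
      exact neg_le_neg (hmax z))
  have h0 := (hc 0).2.2
  rw [circ_zero, circVel_zero, homExt_coe] at h h0
  refine ⟨by linarith [h.1], ?_⟩
  have hp := hpos x
  nlinarith [h.2, h0.2, mul_nonneg hp.le h.2, sq_nonneg (fderiv ℝ (homExt φ) x v)]

/-- At a minimum the gradient vanishes and `Δφ ≥ 0`, so the equation gives the bound. -/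
theorem sq_le_of_isMin (hn : 1 ≤ n) (hs : IsSolution f φ) (hU : ∀ x, (U φ x).IsPositive)
    {x : Sph n} (hmin : ∀ z, φ x ≤ φ z) : n * φ x ^ 2 ≤ 2 * f x + n := by
  let b := EuclideanSpace.basisFun (Fin (n + 1)) ℝ
  have hφ := hs.contMDiff
  have hpos := hs.pos
  have hx := norm_coe_sph x
  have hx0 := coe_sph_ne_zero x
  have hunit : ∀ v : Amb n, ‖v‖ = 1 → ⟪v, (x : Amb n)⟫ = 0 → fderiv ℝ (homExt φ) x v = 0 ∧
      φ x ≤ fderiv ℝ (fderiv ℝ (homExt φ)) x v v := by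
    intro v hv hvx
    have hc := hconvex_along_circ hφ hpos hU hx hv hvx
    have h := second_deriv_nonneg_of_isMin (fun t => (hc t).1) (hc 0).2.1
      (fun t => by
        obtain ⟨z, hz⟩ := homExt_circ_coe (φ := φ) hv hvx t
        rw [circ_zero, homExt_coe, hz]
        exact hmin z)
    rw [circ_zero, circVel_zero, homExt_coe] at h
    exact ⟨h.1, by linarith [h.2]⟩
  have hgrad : ‖grad φ x‖ = 0 := by
    obtain ⟨v, hv, hvx, hgv⟩ := exists_unit_tangent_grad hn hφ x
    rw [← hgv, (hunit v hv hvx).1]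
  have htan : ∀ w : Amb n, φ x * (‖w‖ ^ 2 - ⟪w, (x : Amb n)⟫ ^ 2)
      ≤ fderiv ℝ (fderiv ℝ (homExt φ)) x w w := by
    intro w
    rw [← snd_fderiv_homExt_tanPart hφ hx0, ← norm_sq_tanPart hx]
    rcases eq_or_ne (tanPart (x : Amb n) w) 0 with h | h
    · simp [h]
    · obtain ⟨v, hv, hvx, hwv⟩ := exists_unit_of_tangent (inner_tanPart hx w) h
      generalize tanPart (x : Amb n) w = y at *
      have hsc : fderiv ℝ (fderiv ℝ (homExt φ)) x y y
          = ‖y‖ ^ 2 * fderiv ℝ (fderiv ℝ (homExt φ)) x v v := by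
        conv_lhs => rw [hwv]
        simp only [map_smul, _root_.smul_apply, smul_eq_mul]
        ring
      rw [hsc, mul_comm]
      exact mul_le_mul_of_nonneg_left (hunit v hv hvx).2 (sq_nonneg _)
  have hlap : n * φ x ≤ flatLap b (homExt φ) x := by
    have h1 : ∑ i, φ x * (‖b i‖ ^ 2 - ⟪b i, (x : Amb n)⟫ ^ 2) ≤ flatLap b (homExt φ) x :=
      Finset.sum_le_sum fun i _ => htan (b i)
    rw [← Finset.mul_sum, Finset.sum_sub_distrib, sum_inner_sq, hx] at h1
    simp only [b.norm_eq_one, Finset.sum_const, Finset.card_univ, Fintype.card_fin, nsmul_eq_mul,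
      one_pow, mul_one] at h1
    push_cast at h1
    linarith
  have heq := equation_homExt b hs hx0
  rw [homExt_coe, radExt_coe, inv_inv, gradSq_homExt b hφ, hgrad] at heq
  nlinarith [mul_le_mul_of_nonneg_left hlap (hpos x).le]

/-- Half of `M + 1 / M`, with `M` the maximum of `φ`, is a lower bound of `φ`. -/
theorem half_max_le (hn : 1 ≤ n) (hφ : ContMDiff (𝓡 n) 𝓘(ℝ, ℝ) 4 φ)
    (hpos : ∀ x, 0 < φ x) (hU : ∀ x, (U φ x).IsPositive) (hφ_even : IsEven φ) {x : Sph n}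
    (hmax : ∀ z, φ z ≤ φ x) (y : Sph n) : 1 + φ x ^ 2 ≤ 2 * φ x * φ y := by
  have hx := norm_coe_sph x
  have hM1 : 1 ≤ φ x := by
    obtain ⟨v, hv, hvx⟩ := exists_unit_tangent hn x
    exact (one_le_of_isMax hφ hpos hU hmax hv hvx).2
  -- Evenness allows `y` to be replaced by `-y`, so its angle from the maximum point is at most `π /
  -- 2` and `A + b cos T ≥ A`.
  wlog hxy : 0 ≤ ⟪(y : Amb n), (x : Amb n)⟫ generalizing y with H
  · have := H (-y) (by
      have : ((-y : Sph n) : Amb n) = -(y : Amb n) := rfl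
      rw [this, inner_neg_left]
      linarith)
    rwa [hφ_even y] at this
  have hns := norm_sq_tanPart hx (y : Amb n)
  rw [norm_coe_sph y] at hns
  rcases eq_or_ne (tanPart (x : Amb n) y) 0 with h | h
  · rw [h, norm_zero] at hns
    have hs1 : ⟪(y : Amb n), (x : Amb n)⟫ = 1 := by nlinarith
    have hyx : y = x := by
      ext1
      rw [tanPart, hs1, one_smul, sub_eq_zero] at h
      exact h
    rw [hyx]
    nlinarith
  obtain ⟨v, hv, hvx, hwv⟩ := exists_unit_of_tangent (inner_tanPart hx (y : Amb n)) h
  have hc := hconvex_along_circ hφ hpos hU hx hv hvx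
  obtain ⟨s, hs⟩ : ∃ s, s = ⟪(y : Amb n), (x : Amb n)⟫ := ⟨_, rfl⟩
  obtain ⟨T, hT⟩ : ∃ T, T = Real.arccos s := ⟨_, rfl⟩
  rw [← hs] at hxy hns
  have hs1 : s ≤ 1 := by nlinarith [sq_nonneg ‖tanPart (x : Amb n) y‖]
  have hcosT : Real.cos T = s := by rw [hT, Real.cos_arccos (by linarith) hs1]
  have hT0 : 0 ≤ T := hT ▸ Real.arccos_nonneg s
  have hT2 : T ≤ Real.pi / 2 := hT ▸ Real.arccos_le_pi_div_two.mpr hxy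
  have hsinT : Real.sin T = ‖tanPart (x : Amb n) y‖ := by
    rw [hT, Real.sin_arccos, ← Real.sqrt_sq (norm_nonneg (tanPart (x : Amb n) y)), hns, one_pow]
  have hyT : circ (x : Amb n) v T = y := by
    rw [circ, hcosT, hsinT, ← hwv, tanPart, ← hs]
    abel
  obtain ⟨M, hM⟩ : ∃ M, M = φ x := ⟨_, rfl⟩
  rw [← hM] at hM1
  have hM0 : 0 < M := by linarith
  obtain ⟨A, hA⟩ : ∃ A, A = (1 + M ^ 2) / (2 * M) := ⟨_, rfl⟩
  have hA0 : 0 < A := by rw [hA]; positivity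
  have hAM : 2 * M * A = 1 + M ^ 2 := by rw [hA]; field_simp
  have hb0 : 0 ≤ M - A := by nlinarith
  -- Here `χ = b (sin T - sin t) + A sin (T - t)` with `b = M - A ≥ 0`; it is nonnegative because `T
  -- ≤ π / 2`, and `χ'(T) = -(A + b cos T)`.
  have key := comparison_of_hconvex (fun t => (hc t).1) (fun t => (hc t).2.1)
    (fun t => (hc t).2.2.1) (fun t => (hc t).2.2.2)
    (A := A) (b := M - A) (c := 0)
    (a₀ := (M - A) * Real.sin T) (a₁ := A * Real.sin T) (a₂ := -(M - A + A * Real.cos T)) (T := T)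
    hA0 (by linear_combination hAM) (by rw [circ_zero, homExt_coe, hM]; ring)
    (by rw [circ_zero, circVel_zero, (one_le_of_isMax hφ hpos hU hmax hv hvx).1]) hT0 (by ring)
    (by
      intro t ht
      have h1 : 0 ≤ Real.sin (T - t) :=
        Real.sin_nonneg_of_nonneg_of_le_pi (by linarith [ht.2])
          (by linarith [ht.1, Real.pi_pos])
      have h2 : Real.sin t ≤ Real.sin T :=
        Real.sin_le_sin_of_le_of_le_pi_div_two (by linarith [ht.1, Real.pi_pos]) hT2 ht.2
      rw [Real.sin_sub] at h1
      have h3 := mul_nonneg hA0.le h1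
      have h4 := mul_nonneg hb0 (sub_nonneg.mpr h2)
      linarith)
    (by ring)
    (by
      have h5 := mul_nonneg hb0 (hcosT ▸ hxy : 0 ≤ Real.cos T)
      have h6 := Real.sin_sq_add_cos_sq T
      nlinarith)
  rw [hyT, homExt_coe, hcosT] at key
  have h7 := mul_nonneg hb0 hxy
  have h8 : A ≤ φ y := by linarith
  rw [← hM]
  nlinarith [mul_le_mul_of_nonneg_left h8 hM0.le]

/-- The `C⁰` estimate. -/
theorem sq_lt_of_solution (hn : 1 ≤ n) (hf : Continuous f) (hs : IsSolution f φ)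
    (hU : ∀ x, (U φ x).IsPositive) (hφ_even : IsEven φ) (x : Sph n) :
    φ x ^ 2 < 8 / (n : ℝ) * (⨆ y, f y) + 2 := by
  have hcont : Continuous φ := hs.contMDiff.continuous
  have : Nonempty (Sph n) := ⟨x⟩
  obtain ⟨xM, -, hM⟩ := isCompact_univ.exists_isMaxOn Set.univ_nonempty hcont.continuousOn
  obtain ⟨xm, -, hm⟩ := isCompact_univ.exists_isMinOn Set.univ_nonempty hcont.continuousOn
  have hM' : ∀ z, φ z ≤ φ xM := fun z => hM (Set.mem_univ z)
  have hm' : ∀ z, φ xm ≤ φ z := fun z => hm (Set.mem_univ z)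
  have h1 := half_max_le hn hs.contMDiff hs.pos hU hφ_even hM' xm
  have h2 := sq_le_of_isMin hn hs hU hm'
  have h3 : f xm ≤ ⨆ y, f y := le_ciSup (isCompact_range hf).bddAbove xm
  have hn0 : (0 : ℝ) < n := by exact_mod_cast hn
  have hMpos := hs.pos xM
  have hmpos := hs.pos xm
  -- Squaring `h1` and dividing by `M²`, with `M = φ xM`, gives `M² + 2 + 1 / M² ≤ 4 φ(xm)²`;
  -- dropping `1 / M²` makes the estimate strict.
  have h4 : φ xM ^ 2 < 4 * φ xm ^ 2 - 2 := by
    have h5 : (1 + φ xM ^ 2) ^ 2 ≤ (2 * φ xM * φ xm) ^ 2 :=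
      pow_le_pow_left₀ (by positivity) h1 2
    have h6 : φ xM ^ 2 * (φ xM ^ 2) < φ xM ^ 2 * (4 * φ xm ^ 2 - 2) := by nlinarith
    exact lt_of_mul_lt_mul_left h6 (sq_nonneg _)
  have h7 : φ xm ^ 2 ≤ 2 / n * (⨆ y, f y) + 1 := by
    have : 2 / (n : ℝ) * (⨆ y, f y) + 1 = (2 * (⨆ y, f y) + n) / n := by field_simp
    rw [this, le_div_iff₀ hn0]
    linarith
  have h8 : φ x ^ 2 ≤ φ xM ^ 2 := pow_le_pow_left₀ (hs.pos x).le (hM' x) 2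
  have h9 : 8 / (n : ℝ) * (⨆ y, f y) = 4 * (2 / n * (⨆ y, f y)) := by ring
  linarith

end Estimates
end HypChristoffel

namespace HypChristoffel
open Filter Topology

/-! ### Absence of null vectors -/

section FullRank

variable {n : ℕ} {φ f : Sph n → ℝ}

theorem contDiffAt_radExt_inv (hf : ContMDiff (𝓡 n) 𝓘(ℝ, ℝ) ∞ f) (hf_pos : ∀ x, 0 < f x)
    {y : Amb n} (hy : y ≠ 0) : ContDiffAt ℝ 2 (radExt fun x => (f x)⁻¹) y := by
  have h1 : ContDiffAt ℝ 2 (radExt f) y :=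
    (contDiffAt_radExt (k := ⊤) hf hy).of_le (WithTop.coe_le_coe.mpr (le_top (a := (2 : ℕ∞))))
  have h2 : radExt f y ≠ 0 := by
    rw [radExt_of_ne hy]
    exact (hf_pos _).ne'
  refine (h1.inv h2).congr_of_eventuallyEq ?_
  filter_upwards [isOpen_ne.mem_nhds hy] with z hz using radExt_inv f hz

/-- A unit null vector of `U[φ]` is in the kernel of the full quadratic form. -/
theorem null_vector_kernel {ι : Type*} [Fintype ι] (b : OrthonormalBasis ι ℝ (Amb n))
    (hφ : ContMDiff (𝓡 n) 𝓘(ℝ, ℝ) 4 φ) (hpos : ∀ x, 0 < φ x) (hU : ∀ x, (U φ x).IsPositive)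
    {x : Sph n} {e : Tan x} (hnull : ⟪U φ x e, e⟫ = 0) (w : Amb n) :
    2 * homExt φ x * fderiv ℝ (fderiv ℝ (homExt φ)) x e w
      = (1 + gradSq b (homExt φ) x) * ⟪(e : Amb n), w⟫ := by
  have hx0 := coe_sph_ne_zero x
  have hQ := quadratic_form_nonneg b hφ hpos hU hx0
  have h0 := two_mul_inner_U b hφ x (hpos x) e
  have hsym := snd_fderiv_symm
    ((contDiffAt_four_homExt hφ hx0).of_le (by norm_num) : ContDiffAt ℝ 2 (homExt φ) x) w e
  rw [hnull, mul_zero, ← homExt_coe φ x] at h0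
  -- The form on `e + t w` is a nonnegative quadratic in `t` without constant term, so its linear
  -- coefficient must vanish.
  have hd := discrim_le_zero (a := 2 * homExt φ x * fderiv ℝ (fderiv ℝ (homExt φ)) x w w
      - (1 + gradSq b (homExt φ) x) * (‖w‖ ^ 2 - ⟪w, (x : Amb n)⟫ ^ 2))
    (b := 2 * (2 * homExt φ x * fderiv ℝ (fderiv ℝ (homExt φ)) x e w
      - (1 + gradSq b (homExt φ) x) * ⟪(e : Amb n), w⟫)) (c := 0) (by
      intro t
      have h := hQ ((e : Amb n) + t • w)
      rw [norm_coe_sph, norm_add_sq_real, inner_add_left, inner_tan, real_inner_smul_left,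
        real_inner_smul_right, norm_smul, mul_pow, Real.norm_eq_abs, sq_abs] at h
      simp only [map_add, map_smul, _root_.add_apply, _root_.smul_apply, smul_eq_mul, hsym] at h
      refine (sub_nonneg.mpr h).trans_eq ?_
      linear_combination -h0)
  rw [discrim, mul_zero, sub_zero] at hd
  have := pow_eq_zero_iff (two_ne_zero) |>.mp (le_antisymm hd (sq_nonneg _))
  linarith

theorem norm_reflection {E : Type*} [NormedAddCommGroup E] [InnerProductSpace ℝ E] {e : E}
    (he : ‖e‖ = 1) (w : E) : ‖w - (2 * ⟪w, e⟫) • e‖ = ‖w‖ := by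
  have : ‖w - (2 * ⟪w, e⟫) • e‖ ^ 2 = ‖w‖ ^ 2 := by
    rw [norm_sub_sq_real, real_inner_smul_right, norm_smul, he, mul_one, Real.norm_eq_abs, sq_abs]
    ring
  exact (sq_eq_sq₀ (norm_nonneg _) (norm_nonneg _)).mp this

/-- `U[φ]` has no unit null vector: otherwise `null_point_inequality` contradicts the curvature
condition on `f` and the `C⁰` and `C¹` estimates of `φ`. -/
theorem inner_U_ne_zero (hn : 1 ≤ n) (hf : ContMDiff (𝓡 n) 𝓘(ℝ, ℝ) ∞ f)
    (hf_pos : ∀ x, 0 < f x) (hf_cond : CurvCondition f) (hφ_even : IsEven φ)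
    (hs : IsSolution f φ) (hU : ∀ x, (U φ x).IsPositive) (x : Sph n) (e : Tan x)
    (he : ‖(e : Amb n)‖ = 1) : ⟪U φ x e, e⟫ ≠ 0 := by
  intro hnull
  let b := EuclideanSpace.basisFun (Fin (n + 1)) ℝ
  have hφ := hs.contMDiff
  have hpos := hs.pos
  have hx := norm_coe_sph x
  have hx0 := coe_sph_ne_zero x
  have hne : ∀ᶠ y in 𝓝 (x : Amb n), y ≠ 0 := isOpen_ne.mem_nhds hx0
  set g : Amb n → ℝ := radExt fun x => (f x)⁻¹ with hg
  have hgC : ContDiffAt ℝ 2 g x := contDiffAt_radExt_inv hf hf_pos hx0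
  have hgx : g x = (f x)⁻¹ := radExt_coe _ x
  have hgpos : 0 < g x := hgx ▸ inv_pos.mpr (hf_pos x)
  have key := null_point_inequality b (n := n) (by simp) (contDiffAt_four_homExt hφ hx0) hgC
    (by rw [homExt_coe]; exact hpos x) hgpos hx he (inner_tan x e) (fderiv_homExt_self hφ hx0)
    (snd_fderiv_homExt_self_right hφ hx0)
    (hne.mono fun y hy => quadratic_form_nonneg b hφ hpos hU hy)
    (hne.mono fun y hy => equation_homExt b hs hy)
    (null_vector_kernel b hφ hpos hU hnull)
  rw [homExt_coe] at key
  have hdg : DifferentiableAt ℝ g x := hgC.differentiableAt (by norm_num)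
  have hdg' : DifferentiableAt ℝ (fderiv ℝ g) x :=
    (hgC.fderiv_right (m := 1) (by norm_num)).differentiableAt (by norm_num)
  have hdr : DifferentiableAt ℝ (radExt φ) x :=
    (contDiffAt_four_radExt hφ hx0).differentiableAt (by norm_num)
  have hC0 := sq_lt_of_solution hn hf.continuous hs hU hφ_even x
  have hC1 := one_add_norm_grad_sq_le hn hφ hpos hU hφ_even x
  have hcurv := (hf_cond x).inner_nonneg_left e
  simp only [LinearMap.add_apply, LinearMap.sub_apply, LinearMap.smul_apply, LinearMap.id_apply,
    inner_add_left, inner_sub_left, real_inner_smul_left, real_inner_self_eq_norm_sq,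
    inner_hess hdg', norm_grad b hdg, Submodule.coe_norm e, he, ← hgx, one_pow, mul_one,
    ← hg] at hcurv
  -- As `g` is radially constant, the left side pairs `Dg` with the reflection of `Dφ` in `e^⊥`.
  -- Reflection preserves length, and `|Dφ| ≤ φ` by `hC1`.
  have hK : fderiv ℝ g x (basisGrad b (homExt φ) x) - 2 * fderiv ℝ g x e * fderiv ℝ (homExt φ) x e
      ≤ ‖basisGrad b g x‖ * φ x := by
    have h1 : fderiv ℝ g x (basisGrad b (homExt φ) x)
        - 2 * fderiv ℝ g x e * fderiv ℝ (homExt φ) x e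
        = ⟪basisGrad b g x, basisGrad b (radExt φ) x
          - (2 * ⟪basisGrad b (radExt φ) x, (e : Amb n)⟫) • (e : Amb n)⟫ := by
      rw [basisGrad_homExt b hφ, map_add, map_smul, fderiv_radExt_self hx0 hdg, inner_basisGrad, map_sub, map_smul,
        inner_basisGrad, fderiv_homExt_tangent hφ hx (inner_tan x e)]
      simp only [smul_eq_mul]
      ring
    rw [h1]
    refine (real_inner_le_norm _ _).trans ?_
    rw [norm_reflection he, ← norm_grad b hdr]
    refine mul_le_mul_of_nonneg_left ?_ (norm_nonneg _)
    exact (sq_le_sq₀ (norm_nonneg _) (hpos x).le).mp (by linarith)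
  generalize fderiv ℝ g x (basisGrad b (homExt φ) x)
    - 2 * fderiv ℝ g x e * fderiv ℝ (homExt φ) x e = K at *
  generalize ‖basisGrad b g x‖ = G at *
  generalize fderiv ℝ (fderiv ℝ g) x e e = D at *
  generalize g x = γ at *
  generalize 8 / (n : ℝ) * (⨆ y, f y) + 2 = c at *
  have hp := hpos x
  generalize φ x = p at *
  have h2 : K / (γ ^ 2 * p) ≤ G / γ ^ 2 := by
    rw [div_le_div_iff₀ (by positivity) (by positivity)]
    nlinarith [mul_le_mul_of_nonneg_left hK (sq_nonneg γ)]
  have h3 : (-D + G) / γ ^ 2 ≤ (γ / c) / γ ^ 2 :=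
    div_le_div_of_nonneg_right (by linarith) (sq_nonneg γ)
  -- This is `φ² < c` in disguise; the constant in the condition on `f` is the one from the `C⁰`
  -- estimate.
  have h4 : (γ / c) / γ ^ 2 < 1 / (γ * p ^ 2) := by
    have hc : 0 < c := by nlinarith
    rw [div_div, div_lt_div_iff₀ (by positivity) (by positivity)]
    nlinarith [mul_pos hgpos hgpos, mul_pos (mul_pos hgpos hgpos) (sub_pos.mpr hC0)]
  rw [add_div] at h3
  linarith

end FullRank
end HypChristoffel

theorem theorem4p1 (n : ℕ) (hn : 1 ≤ n)
    (f : HypChristoffel.Sph n → ℝ)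
    (hf_smooth : ContMDiff (𝓡 n) 𝓘(ℝ, ℝ) ∞ f)
    (hf_pos : ∀ x, 0 < f x)
    (hf_even : HypChristoffel.IsEven f)
    (hf_cond : HypChristoffel.CurvCondition f)
    (φ : HypChristoffel.Sph n → ℝ)
    (hφ_even : HypChristoffel.IsEven φ)
    (hφ : HypChristoffel.IsHConvexSolution f φ)
    (hφ_int : HypChristoffel.IntegralIdentity φ) :
    HypChristoffel.IsEven φ ∧ HypChristoffel.IsUniformlyHConvexSolution f φ := by
  refine ⟨hφ_even, hφ.1, fun x => ⟨(hφ.2 x).isSymmetric, fun v hv => ?_⟩⟩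
  refine lt_of_le_of_ne ((hφ.2 x).inner_nonneg_left v) fun hnull => ?_
  have hv0 : ‖v‖ ≠ 0 := norm_ne_zero_iff.mpr hv
  refine HypChristoffel.inner_U_ne_zero hn hf_smooth hf_pos hf_cond hφ_even hφ.1 hφ.2 x
    (‖v‖⁻¹ • v) ?_ ?_
  · rw [← Submodule.coe_norm, norm_smul, norm_inv, norm_norm, inv_mul_cancel₀ hv0]
  · rw [map_smul, real_inner_smul_left, real_inner_smul_right, ← hnull, mul_zero, mul_zero]
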